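/- Let $S^1=\mathbb R/\mathbb Z$ with Lebesgue measure $m$, let $D^2\subset\mathbb R^2$ be the closed unit disc with the Euclidean distance, and $X=S^1\times D^2$. Let $F:X\to X$ be a solenoidal map, i.e. a skew product $F(x,y)=(T(x),G(x,y))$ where $T:S^1\to S^1$ is of class $C^2$ and expanding ($|T'|>1$ everywhere), $G:X\to D^2$ is of class $C^2$ (so that $\partial G/\partial x$ is bounded), and the leaves $\{x\}\times D^2$ are uniformly contracted: there is $0<\alpha<1$ with $|G(x,y_1)-G(x,y_2)|\le\alpha|y_1-y_2|$ for all $x\in S^1$, $y_1,y_2\in D^2$. For a finite signed Borel measure $\mu$ on $X$ let $L_F\mu(E)=\mu(F^{-1}(E))$. For finite positive measures $\nu_1,\nu_2$ on $D^2$ put $W_1^0(\nu_1,\nu_2)=\sup\{|\int g\,d\nu_1-\int g\,d\nu_2| : g:D^2\to\mathbb R,\ \mathrm{Lip}(g)\le1,\ \|g\|_\infty\le1\}$. Write $\mu=\mu^+-\mu^-$ for the Jordan decomposition and $\pi_x:X\to S^1$ for the projection. Let $\mathcal{AB}$ be the set of finite signed Borel measures $\mu$ on $X$ such that $(\pi_x)_*\mu^{\pm}\ll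 m$; for such $\mu$ let $\phi_x^{\pm}$ be the densities of $(\pi_x)_*\mu^{\pm}$, let $\phi_x=\phi_x^+-\phi_x^-$, and let $\mu^{\pm}|_\gamma=\phi_x^{\pm}(\gamma)\,\mu^{\pm}_\gamma$, where $(\mu^{\pm}_\gamma)_{\gamma\in S^1}$ is the disintegration of $\mu^{\pm}$ into probability measures on the leaves $\{\gamma\}\times D^2\cong D^2$. Put $$\|\mu\|_{"1"}=\int_{S^1}W_1^0(\mu^+|_\gamma,\mu^-|_\gamma)\,dm(\gamma),\qquad \mathcal L^1=\{\mu\in\mathcal{AB}:\|\mu\|_{"1"}<\infty\},\qquad \mathcal V=\{\mu\in\mathcal L^1:\mu(X)=0\}.$$ Finally, $\|\phi\|_{W^{1,1}}=\|\phi\|_1+\|\phi'\|_1$ if $\phi$ agrees almost everywhere with an absolutely continuous function on $S^1$ (with derivative $\phi'\in L^1$), and $\|\phi\|_{W^{1,1}}=\infty$ otherwise. Then: (1) (Exponential convergence to equilibrium) There exist $D>0$ and $0<\beta<1$, depending only on $F$, such that for every $\mu\in\mathcal V$ and every $n\ge1$ one has $L_F^n\mu\in\mathcal L^1$ and $$\|L_F^n\mu\|_{"1"}\le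 D\,\beta^n\left(\|\mu\|_{"1"}+\|\phi_x\|_{W^{1,1}}\right).$$ (2) (Existence and uniqueness of the invariant measure) There is a positive measure $\mu\in\mathcal L^1$ with $\mu(X)=1$ and $L_F\mu=\mu$, and it is unique in $\mathcal L^1$ up to normalisation: every $\nu\in\mathcal L^1$ with $L_F\nu=\nu$ satisfies $\nu=\nu(X)\,\mu$. -/

import Mathlib

open MeasureTheory Set
open scoped ENNReal

noncomputable section

namespace Solenoid

/-- The closed unit disc `D²` of the Euclidean plane. -/
abbrev Disc : Type := ↥(Metric.closedBall (0 : EuclideanSpace ℝ (Fin 2)) 1)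

instance : Nonempty Disc := ⟨⟨0, by simp⟩⟩

instance : StandardBorelSpace Disc := Metric.isClosed_closedBall.measurableSet.standardBorel

/-- The filled torus `X = S¹ × D²`, where `S¹ = ℝ / ℤ`. -/
abbrev SolidTorus : Type := UnitAddCircle × Disc

/-- `T : S¹ → S¹` is a `C²` expanding map: it has a `C²` lift `τ : ℝ → ℝ` to the universal cover,
with `|τ'| > 1` everywhere. (The degree of `T` is the constant integer `τ (x + 1) - τ x`.) -/
def IsExpandingMap (T : UnitAddCircle → UnitAddCircle) : Prop :=
  ∃ τ : ℝ → ℝ, ContDiff ℝ 2 τ ∧ (∀ x : ℝ, ((τ x : ℝ) : UnitAddCircle) = T (x : UnitAddCircle)) ∧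
    ∀ x : ℝ, 1 < |deriv τ x|

/-- `G : S¹ × D² → D²` is of class `C²`: in the coordinates `(x, y) ∈ ℝ × D²` of the universal
cover, it is `C²` up to the boundary of the disc. In particular, by compactness, the first
derivatives of `G` are bounded. -/
def IsC2FiberMap (G : SolidTorus → Disc) : Prop :=
  ∃ g : ℝ × EuclideanSpace ℝ (Fin 2) → EuclideanSpace ℝ (Fin 2),
    ContDiffOn ℝ 2 g (univ ×ˢ Metric.closedBall 0 1) ∧
    ∀ (x : ℝ) (y : Disc), g (x, (y : EuclideanSpace ℝ (Fin 2))) = G ((x : UnitAddCircle), y)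

/-- The skew product `F (x, y) = (T x, G (x, y))`. -/
def skewProduct (T : UnitAddCircle → UnitAddCircle) (G : SolidTorus → Disc)
    (p : SolidTorus) : SolidTorus :=
  (T p.1, G p)

/-- The skew product of `T` and `G` is a solenoidal map. -/
structure IsSolenoidal (T : UnitAddCircle → UnitAddCircle) (G : SolidTorus → Disc) : Prop where
  expanding : IsExpandingMap T
  smooth : IsC2FiberMap G
  contracting : ∃ α : ℝ, 0 < α ∧ α < 1 ∧
    ∀ (x : UnitAddCircle) (y₁ y₂ : Disc), dist (G (x, y₁)) (G (x, y₂)) ≤ α * dist y₁ y₂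

/-- The transfer operator `(L_F μ)(E) = μ (F⁻¹ E)` on signed measures (`F` is continuous, hence
measurable, when it is solenoidal). -/
def transfer (F : SolidTorus → SolidTorus) (μ : SignedMeasure SolidTorus) :
    SignedMeasure SolidTorus :=
  μ.map F

/-- The positive part `μ⁺` of the Jordan decomposition. -/
def pos (μ : SignedMeasure SolidTorus) : Measure SolidTorus := μ.toJordanDecomposition.posPart

/-- The negative part `μ⁻` of the Jordan decomposition. -/
def neg (μ : SignedMeasure SolidTorus) : Measure SolidTorus := μ.toJordanDecomposition.negPart

instance (μ : SignedMeasure SolidTorus) : IsFiniteMeasure (pos μ) :=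
  μ.toJordanDecomposition.posPart_finite

instance (μ : SignedMeasure SolidTorus) : IsFiniteMeasure (neg μ) :=
  μ.toJordanDecomposition.negPart_finite

/-- The space `𝒜ℬ`: the marginals on `S¹` of `μ⁺` and `μ⁻` are absolutely continuous with respect
to Lebesgue measure. -/
def IsAB (μ : SignedMeasure SolidTorus) : Prop :=
  (pos μ).fst ≪ volume ∧ (neg μ).fst ≪ volume

/-- The restriction `ν|_γ = φ(γ) ν_γ` of a finite positive measure to the leaf `{γ} × D²`, as a
measure on `D²`: here `φ` is the density of the marginal of `ν` on `S¹` and `(ν_γ)` is the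
disintegration of `ν` into probability measures on the leaves. -/
def leaf (ν : Measure SolidTorus) [IsFiniteMeasure ν] (γ : UnitAddCircle) : Measure Disc :=
  ν.fst.rnDeriv volume γ • ν.condKernel γ

/-- The Wasserstein-Kantorovich-like distance
`W₁⁰(ν₁, ν₂) = sup { |∫ g dν₁ - ∫ g dν₂| : Lip g ≤ 1, ‖g‖_∞ ≤ 1 }`. -/
def wasserstein (ν₁ ν₂ : Measure Disc) : ℝ≥0∞ :=
  ⨆ (g : Disc → ℝ) (_ : LipschitzWith 1 g) (_ : ∀ y, |g y| ≤ 1),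
    ENNReal.ofReal |∫ y, g y ∂ν₁ - ∫ y, g y ∂ν₂|

/-- The norm `‖μ‖_"1" = ∫_{S¹} W₁⁰(μ⁺|_γ, μ⁻|_γ) dm(γ)`. -/
def weakNorm (μ : SignedMeasure SolidTorus) : ℝ≥0∞ :=
  ∫⁻ γ : UnitAddCircle, wasserstein (leaf (pos μ) γ) (leaf (neg μ) γ)

/-- The space `ℒ¹` of disintegrated signed measures. -/
def spaceL1 : Set (SignedMeasure SolidTorus) := {μ | IsAB μ ∧ weakNorm μ < ∞}

/-- The space `𝒱` of zero average measures in `ℒ¹`. -/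
def zeroAverage : Set (SignedMeasure SolidTorus) := {μ | μ ∈ spaceL1 ∧ μ univ = 0}

/-- The marginal density `φ_x = φ_x⁺ - φ_x⁻` of `μ` on `S¹`. -/
def marginalDensity (μ : SignedMeasure SolidTorus) (γ : UnitAddCircle) : ℝ :=
  ((pos μ).fst.rnDeriv volume γ).toReal - ((neg μ).fst.rnDeriv volume γ).toReal

/-- `f` is absolutely continuous on the circle `S¹ = ℝ / ℤ` with derivative `f' ∈ L¹`.
(At `x = 1` the condition forces `∫ f' = 0`, since `f` is a function on the circle.) -/
def HasL1Deriv (f f' : UnitAddCircle → ℝ) : Prop :=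
  Integrable f' volume ∧
    ∀ x ∈ Icc (0 : ℝ) 1,
      f (x : UnitAddCircle) = f 0 + ∫ t in (0 : ℝ)..x, f' (t : UnitAddCircle)

/-- The Sobolev norm `‖φ‖_{W^{1,1}} = ‖φ‖_1 + ‖φ'‖_1` of (the almost everywhere class of) `φ`.
The absolutely continuous representative is unique and its derivative is unique almost everywhere,
so the infimum ranges over a single value; it is `∞` if `φ` does not belong to `W^{1,1}(S¹)`. -/
def sobolevNorm (φ : UnitAddCircle → ℝ) : ℝ≥0∞ :=
  ⨅ (f : UnitAddCircle → ℝ) (f' : UnitAddCircle → ℝ) (_ : HasL1Deriv f f')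
    (_ : f =ᵐ[volume] φ), eLpNorm f 1 volume + eLpNorm f' 1 volume

end Solenoid

end

/-! The weak norm is used through duality: for `μ` in `𝒜ℬ` it is the supremum of `∫ h dμ` over
measurable `h` that are bounded by 1 and 1-Lipschitz along each leaf, with no regularity required
across leaves (`le_weakNorm`, `weakNorm_le`). Since `∫ h d(L_F^n μ) = ∫ h ∘ F^n dμ`, everything
becomes a statement about `h ∘ F^n`.

Write `n = k + l`. Contraction of the leaves makes `h ∘ F^k` a function `v` of the base point plus
`α ^ k` times a test function, and this persists after composing with `F^l`. Hence `|∫ h d(L_F^n μ)|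
≤ α ^ k ‖μ‖ + |∫ (v ∘ T^l) φ_x dm|`, where `v` is merely measurable and bounded by 1
(`exists_abs_signedIntegral_iterate_le`). What remains is decay of correlations for `T` against such
observables.

On the circle, the transfer operator of `T` shrinks the log-Lipschitz constant of positive
densities. Two densities of equal mass in a suitable cone therefore share, after one step, a fixed
fraction of their mass; removing it leaves densities in the cone, and iteration gives a rate `θ ^ n`
(`exists_coneData`). Lipschitz densities follow by adding a constant. Integration by parts reduces a
`W^{1,1}` density to indicators of arcs, and smoothing these at scale `√θ ^ n` gives the rate `√θ ^
n` (`decay_of_hasL1Deriv`). With `k` and `l` about `n / 2` this proves (1).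

For an integrable density, approximation gives mixing without a rate (`ConeData.mixes`), so
integrals of test functions against iterates of any zero average measure tend to 0
(`tendsto_signedIntegral_iterate`). This yields uniqueness, and also the invariance of a weak limit
of `F^n_* (m × δ)`; its marginal is absolutely continuous because the densities of `T^n_* m` are
uniformly bounded. -/

noncomputable section

namespace Solenoid

/-! ### Lifts of expanding circle maps -/

/-- Data attached to the lift `τ` of an expanding circle map: the inverse `σ` of `τ`, the weight
`w = 1 / |τ'|`, bounds for expansion and distortion, and the absolute degree `N`. -/
structure LiftData (T : UnitAddCircle → UnitAddCircle) where
  τ : ℝ → ℝ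
  σ : ℝ → ℝ
  w : ℝ → ℝ
  rate : ℝ
  distortion : ℝ
  degree : ℕ
  base : ℝ
  one_lt_rate : 1 < rate
  distortion_nonneg : 0 ≤ distortion
  degree_pos : 0 < degree
  coe_τ : ∀ x : ℝ, ((τ x : ℝ) : UnitAddCircle) = T (x : UnitAddCircle)
  differentiable_τ : Differentiable ℝ τ
  w_eq : ∀ x, w x = |deriv τ x|⁻¹
  deriv_ne : ∀ x, deriv τ x ≠ 0
  w_le : ∀ x y, w x ≤ Real.exp (distortion * |x - y|) * w y
  σ_τ : ∀ x, σ (τ x) = x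
  abs_σ_sub_le : ∀ x y, |σ x - σ y| ≤ |x - y| / rate
  image_τ : τ '' Icc 0 1 = Icc base (base + degree)
  coe_σ_add : ∀ y, ((σ (y + degree) : ℝ) : UnitAddCircle) = σ y
  w_σ_add : ∀ y, w (σ (y + degree)) = w (σ y)

theorem exists_int_add_one_eq {T : UnitAddCircle → UnitAddCircle} {τ : ℝ → ℝ}
    (hτ : Continuous τ) (hT : ∀ x : ℝ, ((τ x : ℝ) : UnitAddCircle) = T (x : UnitAddCircle)) :
    ∃ d : ℤ, ∀ x, τ (x + 1) = τ x + d := by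
  have hint : ∀ x, ∃ d : ℤ, (d : ℝ) = τ (x + 1) - τ x := by
    intro x
    have h : ((τ (x + 1) - τ x : ℝ) : UnitAddCircle) = 0 := by
      rw [AddCircle.coe_sub, hT, hT, AddCircle.coe_add_period, sub_self]
    obtain ⟨n, hn⟩ := (AddCircle.coe_eq_zero_iff (1 : ℝ)).1 h
    exact ⟨n, by simpa using hn⟩
  choose d hd using hint
  have hc : Continuous d := by
    rw [Int.isClosedEmbedding_coe_real.isEmbedding.continuous_iff]
    have : (fun n : ℤ => (n : ℝ)) ∘ d = fun x => τ (x + 1) - τ x := funext hd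
    change Continuous ((fun n : ℤ => (n : ℝ)) ∘ d)
    rw [this]
    fun_prop
  refine ⟨d 0, fun x => ?_⟩
  have h0 : d x = d 0 := PreconnectedSpace.constant inferInstance hc
  rw [← h0, hd]
  ring

theorem bounded_of_periodic {f : ℝ → ℝ} (hf : Continuous f) (hp : Function.Periodic f 1) :
    ∃ C, 0 ≤ C ∧ ∀ x, |f x| ≤ C := by
  obtain ⟨C, hC⟩ := isCompact_Icc.exists_bound_of_continuousOn (s := Icc (0 : ℝ) 1) hf.continuousOn
  have : ∀ x, |f x| ≤ C := by
    intro x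
    obtain ⟨y, hy, hxy⟩ := hp.exists_mem_Ico₀ one_pos x
    rw [hxy]
    exact hC y ⟨hy.1, hy.2.le⟩
  exact ⟨C, (abs_nonneg _).trans (this 0), this⟩

theorem IsExpandingMap.nonempty_liftData {T : UnitAddCircle → UnitAddCircle}
    (h : IsExpandingMap T) : Nonempty (LiftData T) := by
  obtain ⟨τ, hτ, hT, hexp⟩ := h
  have hdiff : Differentiable ℝ τ := hτ.differentiable (by norm_num)
  have hd1 : ContDiff ℝ 1 (deriv τ) := by
    have : ContDiff ℝ (1 + 1) τ := by simpa [one_add_one_eq_two] using hτ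
    exact (contDiff_succ_iff_deriv.1 this).2.2
  have hdc : Continuous (deriv τ) := hd1.continuous
  have hdd : Differentiable ℝ (deriv τ) := hd1.differentiable (by norm_num)
  have hddc : Continuous (deriv (deriv τ)) := hd1.continuous_deriv (by norm_num)
  obtain ⟨d, hd⟩ := exists_int_add_one_eq hdiff.continuous hT
  have hper : Function.Periodic (deriv τ) 1 := by
    intro x
    rw [← deriv_comp_add_const]
    simp [hd]
  have hper2 : Function.Periodic (deriv (deriv τ)) 1 := by
    intro x
    rw [← deriv_comp_add_const]
    congr 1
    exact funext hper
  obtain ⟨B, hB0, hB⟩ := bounded_of_periodic hddc hper2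
  obtain ⟨lam, hlam, hle⟩ : ∃ lam : ℝ, 1 < lam ∧ ∀ x, lam ≤ |deriv τ x| := by
    obtain ⟨z, -, hz⟩ := isCompact_Icc.exists_isMinOn (s := Icc (0 : ℝ) 1) ⟨0, by simp⟩
      hdc.abs.continuousOn
    refine ⟨_, hexp z, fun x => ?_⟩
    obtain ⟨y, hy, hxy⟩ := hper.exists_mem_Ico₀ one_pos x
    rw [hxy]
    exact hz ⟨hy.1, hy.2.le⟩
  have hlam0 : 0 < lam := by linarith
  -- Uniform expansion makes `τ` injective, hence strictly monotone, and unbounded in both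
  -- directions, hence onto.
  have hge : ∀ x y, lam * |x - y| ≤ |τ x - τ y| := by
    have key : ∀ x y, x < y → lam * |x - y| ≤ |τ x - τ y| := by
      intro x y hxy
      obtain ⟨c, -, hc⟩ := exists_deriv_eq_slope τ hxy hdiff.continuous.continuousOn
        hdiff.differentiableOn
      have h1 := hle c
      rw [hc, abs_div, le_div_iff₀ (by simpa [sub_eq_zero] using hxy.ne')] at h1
      rwa [abs_sub_comm x, abs_sub_comm (τ x)]
    intro x y
    rcases lt_trichotomy x y with h | rfl | h
    · exact key x y h
    · simp
    · rw [abs_sub_comm x, abs_sub_comm (τ x)]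
      exact key y x h
  have hinj : Function.Injective τ := by
    intro x y hxy
    have h1 := hge x y
    rw [hxy, sub_self, abs_zero] at h1
    have h2 : |x - y| ≤ 0 := by
      by_contra hcon
      push Not at hcon
      nlinarith
    exact sub_eq_zero.1 (abs_eq_zero.1 (le_antisymm h2 (abs_nonneg _)))
  have hmono := hdiff.continuous.strictMono_of_inj hinj
  have hsurj : Function.Surjective τ := by
    rcases hmono with hm | hm
    · refine hdiff.continuous.surjective ?_ ?_
      · refine Filter.tendsto_atTop_mono' _ ?_
          (Filter.tendsto_atTop_add_const_left _ (τ 0) Filter.tendsto_id)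
        filter_upwards [Filter.eventually_ge_atTop 0] with x hx
        have h1 := hge x 0
        rw [sub_zero, abs_of_nonneg hx, abs_of_nonneg (sub_nonneg.2 (hm.monotone hx))] at h1
        simp only [id]
        nlinarith
      · refine Filter.tendsto_atBot_mono' _ ?_
          (Filter.tendsto_atBot_add_const_left _ (τ 0) Filter.tendsto_id)
        filter_upwards [Filter.eventually_le_atBot 0] with x hx
        have h1 := hge x 0
        rw [sub_zero, abs_of_nonpos hx, abs_of_nonpos (sub_nonpos.2 (hm.monotone hx))] at h1
        simp only [id]
        nlinarith
    · refine hdiff.continuous.surjective' ?_ ?_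
      · refine Filter.tendsto_atTop_mono' _ ?_
          (Filter.tendsto_atTop_add_const_left _ (τ 0) Filter.tendsto_neg_atBot_atTop)
        filter_upwards [Filter.eventually_le_atBot 0] with x hx
        have h1 := hge x 0
        rw [sub_zero, abs_of_nonpos hx, abs_of_nonneg (sub_nonneg.2 (hm.antitone hx))] at h1
        nlinarith
      · refine Filter.tendsto_atBot_mono' _ ?_
          (Filter.tendsto_atBot_add_const_left _ (τ 0) Filter.tendsto_neg_atTop_atBot)
        filter_upwards [Filter.eventually_ge_atTop 0] with x hx
        have h1 := hge x 0
        rw [sub_zero, abs_of_nonneg hx, abs_of_nonpos (sub_nonpos.2 (hm.antitone hx))] at h1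
        nlinarith
  let e : ℝ ≃ ℝ := Equiv.ofBijective τ ⟨hinj, hsurj⟩
  have heτ : ∀ x, e.symm (τ x) = x := fun x => e.symm_apply_apply x
  have hτe : ∀ y, τ (e.symm y) = y := fun y => e.apply_symm_apply y
  -- Since `|τ'| ≥ 1`, the bound `B` on `|τ''|` gives `|τ' y| ≤ |τ' x| (1 + B |x - y|)`, and `1 + t
  -- ≤ exp t`.
  have hwle : ∀ x y, |deriv τ x|⁻¹ ≤ Real.exp (B * |x - y|) * |deriv τ y|⁻¹ := by
    intro x y
    have hx : 0 < |deriv τ x| := by linarith [hle x]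
    have hy : 0 < |deriv τ y| := by linarith [hle y]
    have h1 : ‖deriv τ y - deriv τ x‖ ≤ B * ‖y - x‖ :=
      Convex.norm_image_sub_le_of_norm_deriv_le (s := univ) (fun z _ => hdd z)
        (fun z _ => hB z) convex_univ (mem_univ _) (mem_univ _)
    rw [Real.norm_eq_abs, Real.norm_eq_abs, abs_sub_comm y x] at h1
    have h2 : |deriv τ y| ≤ |deriv τ x| + B * |x - y| := by
      linarith [abs_sub_abs_le_abs_sub (deriv τ y) (deriv τ x)]
    have h3 := Real.add_one_le_exp (B * |x - y|)
    have h4 : 0 ≤ B * |x - y| := by positivity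
    rw [← div_eq_mul_inv, le_div_iff₀ hy, inv_mul_le_iff₀ hx]
    have h5 : 1 ≤ |deriv τ x| := (hexp x).le
    nlinarith
  have hσ : ∀ x y, |e.symm x - e.symm y| ≤ |x - y| / lam := by
    intro x y
    have := hge (e.symm x) (e.symm y)
    rw [hτe, hτe] at this
    rw [le_div_iff₀ hlam0]
    linarith
  have h01 : τ 1 = τ 0 + d := by simpa using hd 0
  rcases hmono with hm | hm
  · have hdpos : 0 < d := by
      have := hm (zero_lt_one' ℝ)
      rw [h01] at this
      exact_mod_cast (by linarith : (0 : ℝ) < d)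
    have hdn : ((d.toNat : ℕ) : ℝ) = d := by exact_mod_cast Int.toNat_of_nonneg hdpos.le
    have hadd : ∀ y, e.symm (y + (d.toNat : ℝ)) = e.symm y + 1 := by
      intro y
      apply hinj
      rw [hτe, hd, hτe, hdn]
    refine ⟨⟨τ, e.symm, fun x => |deriv τ x|⁻¹, lam, B, d.toNat, τ 0, hlam, hB0, by omega, hT, hdiff,
      fun _ => rfl, fun x h0 => ?_, hwle, heτ, hσ, ?_, fun y => ?_, fun y => ?_⟩⟩
    · have := hexp x
      rw [h0, abs_zero] at this
      linarith
    · rw [hdn, ← h01]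
      ext y
      obtain ⟨x, rfl⟩ := hsurj y
      simp [hinj.eq_iff, hm.le_iff_le]
    · rw [hadd, AddCircle.coe_add_period]
    · simp only [hadd, hper _]
  -- Orientation reversing case: the image of `[0, 1]` starts at `τ 1`, and a shift by the absolute
  -- degree moves the inverse back by 1.
  · have hdneg : d < 0 := by
      have := hm (zero_lt_one' ℝ)
      rw [h01] at this
      exact_mod_cast (by linarith : (d : ℝ) < 0)
    have hdn : (((-d).toNat : ℕ) : ℝ) = -d := by
      exact_mod_cast Int.toNat_of_nonneg (by omega : 0 ≤ -d)
    have hadd : ∀ y, e.symm (y + ((-d).toNat : ℝ)) = e.symm y - 1 := by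
      intro y
      apply hinj
      have := hd (e.symm y - 1)
      rw [sub_add_cancel, hτe] at this
      rw [hτe, hdn]
      linarith
    refine ⟨⟨τ, e.symm, fun x => |deriv τ x|⁻¹, lam, B, (-d).toNat, τ 1, hlam, hB0, by omega, hT,
      hdiff, fun _ => rfl, fun x h0 => ?_, hwle, heτ, hσ, ?_, fun y => ?_, fun y => ?_⟩⟩
    · have := hexp x
      rw [h0, abs_zero] at this
      linarith
    · rw [hdn, h01, add_neg_cancel_right, ← h01]
      ext y
      obtain ⟨x, rfl⟩ := hsurj y
      simp [hinj.eq_iff, hm.le_iff_ge, and_comm]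
    · rw [hadd, AddCircle.coe_sub, AddCircle.coe_period, sub_zero]
    · simp only [hadd, hper.sub_eq]

/-! ### Log-Lipschitz densities and the transfer operator of the base map -/

/-- `f` is nonnegative and its logarithm is Lipschitz with constant `a`. -/
def LogLip (a : ℝ) (f : UnitAddCircle → ℝ) : Prop :=
  (∀ x, 0 ≤ f x) ∧ ∀ x y : ℝ, f x ≤ Real.exp (a * |x - y|) * f y

theorem continuous_of_le_exp_mul {a : ℝ} {f : ℝ → ℝ}
    (h : ∀ x y : ℝ, f x ≤ Real.exp (a * |x - y|) * f y) : Continuous f := by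
  rw [continuous_iff_continuousAt]
  intro y
  have h1 : Filter.Tendsto (fun x => Real.exp (-(a * |y - x|)) * f y) (nhds y) (nhds (f y)) := by
    have : Continuous fun x => Real.exp (-(a * |y - x|)) * f y := by fun_prop
    simpa using this.tendsto y
  have h2 : Filter.Tendsto (fun x => Real.exp (a * |x - y|) * f y) (nhds y) (nhds (f y)) := by
    have : Continuous fun x => Real.exp (a * |x - y|) * f y := by fun_prop
    simpa using this.tendsto y
  refine tendsto_of_tendsto_of_tendsto_of_le_of_le h1 h2 (fun x => ?_) (fun x => h x y)
  simp only
  rw [Real.exp_neg, inv_mul_le_iff₀ (Real.exp_pos _)]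
  exact h y x

theorem isQuotientMap_coe : Topology.IsQuotientMap ((↑) : ℝ → UnitAddCircle) :=
  isQuotientMap_quotient_mk'

theorem LogLip.continuous {a : ℝ} {f : UnitAddCircle → ℝ} (hf : LogLip a f) : Continuous f :=
  isQuotientMap_coe.continuous_iff.2 (continuous_of_le_exp_mul (f := fun x : ℝ => f x) hf.2)

theorem intervalIntegrable_bdd_mul {v k : ℝ → ℝ} {C : ℝ} (hv : Measurable v) (hC : ∀ x, |v x| ≤ C)
    (hk : Continuous k) (s t : ℝ) : IntervalIntegrable (fun x => v x * k x) volume s t := by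
  have h := hk.intervalIntegrable (μ := volume) s t
  exact ⟨h.1.bdd_mul hv.aestronglyMeasurable (Filter.Eventually.of_forall hC),
    h.2.bdd_mul hv.aestronglyMeasurable (Filter.Eventually.of_forall hC)⟩

/-- Inverse branches contract distances by `rate`, so both the constant `a` of `f` and the
distortion of the weight are divided by `rate`. -/
theorem LiftData.exists_transfer {T : UnitAddCircle → UnitAddCircle} (L : LiftData T) {a : ℝ}
    (ha : 0 ≤ a) {f : UnitAddCircle → ℝ} (hf : LogLip a f) :
    ∃ g, LogLip ((a + L.distortion) / L.rate) g ∧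
      ∀ u : UnitAddCircle → ℝ, Measurable u → (∃ C, ∀ x, |u x| ≤ C) →
        ∫ x, u (T x) * f x = ∫ x, u x * g x := by
  obtain ⟨τ, σ, w, lam, B, N, p, hlam, hB, hN, hT, hdiff, hw, hne, hwle, hστ, hσ, him, hσN, hwN⟩ := L
  simp only
  have hlam0 : 0 < lam := by linarith
  have hw0 : ∀ x, 0 < w x := fun x => by
    rw [hw]
    exact inv_pos.2 (abs_pos.2 (hne x))
  set h : ℝ → ℝ := fun y => f (σ y) * w (σ y) with hh
  have hle : ∀ x y, h x ≤ Real.exp ((a + B) / lam * |x - y|) * h y := by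
    intro x y
    have h1 := hf.2 (σ x) (σ y)
    have h2 := hwle (σ x) (σ y)
    have h3 : Real.exp (a * |σ x - σ y|) * Real.exp (B * |σ x - σ y|)
        ≤ Real.exp ((a + B) / lam * |x - y|) := by
      rw [← Real.exp_add, Real.exp_le_exp, ← add_mul, div_mul_eq_mul_div, mul_div_assoc]
      exact mul_le_mul_of_nonneg_left (hσ x y) (by positivity)
    calc h x ≤ (Real.exp (a * |σ x - σ y|) * f (σ y)) * (Real.exp (B * |σ x - σ y|) * w (σ y)) :=
          mul_le_mul h1 h2 (hw0 _).le (mul_nonneg (Real.exp_pos _).le (hf.1 _))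
      _ = (Real.exp (a * |σ x - σ y|) * Real.exp (B * |σ x - σ y|)) * h y := by simp only [hh]; ring
      _ ≤ _ := mul_le_mul_of_nonneg_right h3 (mul_nonneg (hf.1 _) (hw0 _).le)
  have hcont : Continuous h := continuous_of_le_exp_mul hle
  have hperN : ∀ y, h (y + N) = h y := fun y => by simp only [hh, hσN, hwN]
  -- The preimages of the class of `y` are represented by the `σ (y + k)`, `k < N`. A unit shift
  -- only permutes the terms cyclically, since `h` has period `N`.
  set q : ℝ → ℝ := fun y => ∑ k ∈ Finset.range N, h (y + k) with hq
  have hqper : Function.Periodic q 1 := by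
    intro y
    simp only [hq]
    have h1 : ∀ k : ℕ, h (y + 1 + k) = h (y + (k + 1 : ℕ)) := fun k => by
      congr 1; push_cast; ring
    simp only [h1]
    have h2 := Finset.sum_range_succ' (fun k : ℕ => h (y + k)) N
    have h3 := Finset.sum_range_succ (fun k : ℕ => h (y + k)) N
    simp only [Nat.cast_zero, add_zero] at h2
    simp only [hperN] at h3
    linarith
  refine ⟨hqper.lift, ⟨?_, ?_⟩, ?_⟩
  · intro x
    obtain ⟨x, rfl⟩ := QuotientAddGroup.mk_surjective x
    change 0 ≤ q x
    exact Finset.sum_nonneg fun k _ => mul_nonneg (hf.1 _) (hw0 _).le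
  · intro x y
    change q x ≤ _ * q y
    simp only [hq, Finset.mul_sum]
    refine Finset.sum_le_sum fun k _ => ?_
    simpa using hle (x + k) (y + k)
  · rintro u hu ⟨C, hC⟩
    have hint : ∀ s t : ℝ, IntervalIntegrable (fun y : ℝ => u y * h y) volume s t :=
      fun s t => intervalIntegrable_bdd_mul (hu.comp AddCircle.measurable_mk') (fun x => hC x) hcont s t
    rw [← UnitAddCircle.integral_preimage 0, ← UnitAddCircle.intervalIntegral_preimage p, zero_add,
      ← integral_Icc_eq_integral_Ioc]
    calc ∫ x in Icc (0 : ℝ) 1, u (T x) * f x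
        = ∫ x in Icc (0 : ℝ) 1, |deriv τ x| • (u (τ x : ℝ) * h (τ x)) := by
          refine setIntegral_congr_fun measurableSet_Icc fun x _ => ?_
          have := abs_pos.2 (hne x)
          simp only [hh, hστ, hT, hw, smul_eq_mul]
          field_simp
      _ = ∫ y in τ '' Icc 0 1, u y * h y :=
          (integral_image_eq_integral_abs_deriv_smul (F := ℝ) (g := fun y : ℝ => u y * h y)
            measurableSet_Icc (fun x _ => (hdiff x).hasDerivAt.hasDerivWithinAt)
            (Function.LeftInverse.injective hστ).injOn).symm
      _ = ∫ y in p..p + N, u y * h y := by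
          rw [him, integral_Icc_eq_integral_Ioc, intervalIntegral.integral_of_le (by simp)]
      _ = ∑ k ∈ Finset.range N, ∫ y in (p + k)..(p + (k + 1 : ℕ)), u y * h y := by
          have := intervalIntegral.sum_integral_adjacent_intervals (n := N)
            (a := fun k : ℕ => p + k) (μ := volume) (f := fun y : ℝ => u y * h y)
            fun k _ => hint _ _
          simpa using this.symm
      _ = ∑ k ∈ Finset.range N, ∫ y in p..p + 1, u y * h (y + k) := by
          refine Finset.sum_congr rfl fun k _ => ?_
          have := intervalIntegral.integral_comp_add_right (a := p) (b := p + 1)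
            (fun y : ℝ => u y * h y) (k : ℝ)
          rw [show p + 1 + (k : ℝ) = p + (k + 1 : ℕ) by push_cast; ring] at this
          rw [← this]
          refine intervalIntegral.integral_congr fun y _ => ?_
          have hk : ((y + k : ℝ) : UnitAddCircle) = y := by
            have h1 : ((k : ℝ) : UnitAddCircle) = 0 :=
              (AddCircle.coe_eq_zero_iff (1 : ℝ)).2 ⟨k, by simp⟩
            rw [AddCircle.coe_add, h1, add_zero]
          simp only [hk]
      _ = ∫ y in p..p + 1, u y * hqper.lift (y : UnitAddCircle) := by
          rw [← intervalIntegral.integral_finsetSum]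
          · refine intervalIntegral.integral_congr fun y _ => ?_
            change _ = u y * q y
            simp only [hq, Finset.mul_sum]
          · intro k _
            exact intervalIntegrable_bdd_mul (hu.comp AddCircle.measurable_mk') (fun x => hC x)
              (hcont.comp (continuous_add_const (k : ℝ))) p (p + 1)


instance : IsProbabilityMeasure (volume : Measure UnitAddCircle) := ⟨UnitAddCircle.measure_univ⟩

theorem LiftData.continuous {T : UnitAddCircle → UnitAddCircle} (L : LiftData T) :
    Continuous T := by
  rw [isQuotientMap_coe.continuous_iff]
  have : T ∘ ((↑) : ℝ → UnitAddCircle) = fun x => ((L.τ x : ℝ) : UnitAddCircle) :=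
    funext fun x => (L.coe_τ x).symm
  rw [this]
  exact continuous_quotient_mk'.comp L.differentiable_τ.continuous

theorem dist_coe_le (x y : ℝ) : dist (x : UnitAddCircle) (y : UnitAddCircle) ≤ |x - y| := by
  rw [dist_eq_norm, ← AddCircle.coe_sub]
  exact QuotientAddGroup.norm_mk_le_norm

theorem dist_le_one (x y : UnitAddCircle) : dist x y ≤ 1 := by
  rw [dist_eq_norm]
  have := AddCircle.norm_le_half_period (1 : ℝ) (x := x - y) one_ne_zero
  norm_num at this
  linarith

theorem _root_.Continuous.integrable_unitAddCircle {f : UnitAddCircle → ℝ} (hf : Continuous f) :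
    Integrable f :=
  hf.integrable_of_hasCompactSupport (HasCompactSupport.of_compactSpace f)

theorem LogLip.mono {a b : ℝ} (hab : a ≤ b) {f : UnitAddCircle → ℝ} (hf : LogLip a f) :
    LogLip b f :=
  ⟨hf.1, fun x y => (hf.2 x y).trans (mul_le_mul_of_nonneg_right
    (Real.exp_le_exp.2 (mul_le_mul_of_nonneg_right hab (abs_nonneg _))) (hf.1 _))⟩

theorem logLip_const {a c : ℝ} (ha : 0 ≤ a) (hc : 0 ≤ c) : LogLip a fun _ => c :=
  ⟨fun _ => hc, fun x y => le_mul_of_one_le_left hc (Real.one_le_exp (by positivity))⟩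

theorem LogLip.le_exp_mul {a : ℝ} (ha : 0 ≤ a) {f : UnitAddCircle → ℝ} (hf : LogLip a f)
    (x y : UnitAddCircle) : f x ≤ Real.exp a * f y := by
  obtain ⟨x, hx, rfl⟩ := AddCircle.eq_coe_Ico x
  obtain ⟨y, hy, rfl⟩ := AddCircle.eq_coe_Ico y
  refine (hf.2 x y).trans (mul_le_mul_of_nonneg_right (Real.exp_le_exp.2 ?_) (hf.1 _))
  have : |x - y| ≤ 1 := by
    rw [abs_le]
    constructor <;> linarith [hx.1, hx.2, hy.1, hy.2]
  nlinarith

theorem LogLip.integral_le {a : ℝ} (ha : 0 ≤ a) {f : UnitAddCircle → ℝ} (hf : LogLip a f)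
    (y : UnitAddCircle) : ∫ x, f x ≤ Real.exp a * f y := by
  have := integral_mono hf.continuous.integrable_unitAddCircle
    (integrable_const (Real.exp a * f y)) fun x => hf.le_exp_mul ha x y
  simpa using this

theorem LogLip.le_integral {a : ℝ} (ha : 0 ≤ a) {f : UnitAddCircle → ℝ} (hf : LogLip a f)
    (x : UnitAddCircle) : f x ≤ Real.exp a * ∫ y, f y := by
  have := integral_mono (integrable_const (f x))
    (hf.continuous.integrable_unitAddCircle.const_mul (Real.exp a)) fun y => hf.le_exp_mul ha x y
  rw [integral_const_mul] at this
  simpa using this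

/-- Strict contraction of the constant leaves room to subtract mass. Convexity gives `exp (a (1 - ε)
t) ≤ (1 - ε) exp (a t) + ε`, and the slack `ε (exp (a t) - 1) f y` pays for `c (exp (a t) - 1)`. -/
theorem LogLip.sub_const {a b ε c : ℝ} {f : UnitAddCircle → ℝ} (hf : LogLip b f)
    (ha : 0 ≤ a) (hε : 0 ≤ ε) (hε1 : ε ≤ 1) (hb : b ≤ a * (1 - ε)) (hc : ∀ x, c ≤ ε * f x) :
    LogLip a fun x => f x - c := by
  refine ⟨fun x => ?_, fun x y => ?_⟩
  · have := hc x
    have := mul_le_mul_of_nonneg_right hε1 (hf.1 x)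
    linarith
  · have h1 := (hf.mono hb).2 x y
    have h2 : Real.exp (a * (1 - ε) * |x - y|) ≤ (1 - ε) * Real.exp (a * |x - y|) + ε := by
      have := convexOn_exp.2 (mem_univ (a * |x - y|)) (mem_univ 0) (sub_nonneg.2 hε1) hε
        (by ring)
      simp only [smul_eq_mul, mul_zero, add_zero, Real.exp_zero, mul_one] at this
      rwa [show a * (1 - ε) * |x - y| = (1 - ε) * (a * |x - y|) by ring]
    have h3 : 1 ≤ Real.exp (a * |x - y|) := Real.one_le_exp (by positivity)
    have h4 := mul_le_mul_of_nonneg_right h2 (hf.1 y)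
    have h5 := mul_le_mul_of_nonneg_right (hc y) (sub_nonneg.2 h3)
    nlinarith

/-- The shift keeps values above `K / a`, and there an increment of `K |x - y|` is at most a
relative increment of `a |x - y|`. -/
theorem logLip_of_lipschitz {a K : ℝ} (ha : 0 < a) {φ : UnitAddCircle → ℝ}
    (hK : 0 ≤ K) (hφ : ∀ x y, |φ x - φ y| ≤ K * dist x y) (hb : ∀ x, |φ x| ≤ K) :
    LogLip a fun x => φ x + K * (1 + 1 / a) := by
  have hKa : 0 ≤ K / a := by positivity
  have hM : K * (1 + 1 / a) = K + K / a := by ring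
  have hge : ∀ x, K / a ≤ φ x + K * (1 + 1 / a) := fun x => by
    linarith [neg_le_of_abs_le (hb x)]
  refine ⟨fun x => hKa.trans (hge x), fun x y => ?_⟩
  have h1 : φ x - φ y ≤ K * |x - y| := (le_abs_self _).trans ((hφ x y).trans
    (mul_le_mul_of_nonneg_left (dist_coe_le x y) hK))
  have h2 := Real.add_one_le_exp (a * |x - y|)
  have h3 := mul_le_mul_of_nonneg_right h2 (hKa.trans (hge y))
  have h4 := mul_le_mul_of_nonneg_left (hge y) (by positivity : 0 ≤ a * |x - y|)
  have h5 : a * |x - y| * (K / a) = K * |x - y| := by field_simp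
  linarith

/-! ### Cone contraction and decay for Lipschitz densities -/

/-- `a` is the aperture of a cone of log-Lipschitz densities on which the transfer operator of `T`
acts, and it contracts differences of densities of equal mass at the rate `θ`. -/
structure ConeData (T : UnitAddCircle → UnitAddCircle) (a θ : ℝ) : Prop where
  a_pos : 0 < a
  θ_pos : 0 < θ
  θ_lt : θ < 1
  measurable : Measurable T
  exists_density : ∀ (n : ℕ) (f : UnitAddCircle → ℝ), LogLip a f → ∃ g, LogLip a g ∧
    ∀ u : UnitAddCircle → ℝ, Measurable u → (∃ C, ∀ x, |u x| ≤ C) →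
      ∫ x, u (T^[n] x) * f x = ∫ x, u x * g x
  decay : ∀ (n : ℕ) (f g : UnitAddCircle → ℝ), LogLip a f → LogLip a g → ∫ x, f x = ∫ x, g x →
    ∀ u : UnitAddCircle → ℝ, Measurable u → (∀ x, |u x| ≤ 1) →
      |∫ x, u (T^[n] x) * (f x - g x)| ≤ 2 * θ ^ n * ∫ x, f x

theorem integrable_bdd_mul {α : Type*} [MeasurableSpace α] {μ : Measure α} {u f : α → ℝ} {C : ℝ}
    (hu : Measurable u) (hC : ∀ x, |u x| ≤ C) (hf : Integrable f μ) :
    Integrable (fun x => u x * f x) μ :=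
  hf.bdd_mul hu.aestronglyMeasurable (Filter.Eventually.of_forall hC)

theorem abs_integral_mul_le {α : Type*} [MeasurableSpace α] {μ : Measure α} {u f : α → ℝ}
    (hC : ∀ x, |u x| ≤ 1) (hf : Integrable f μ) :
    |∫ x, u x * f x ∂μ| ≤ ∫ x, |f x| ∂μ := by
  rw [← Real.norm_eq_abs]
  refine norm_integral_le_of_norm_le hf.abs (Filter.Eventually.of_forall fun x => ?_)
  rw [Real.norm_eq_abs, abs_mul]
  exact mul_le_of_le_one_left (abs_nonneg _) (hC x)

/-- Coupling: after one step each of the two densities dominates the same constant, `c` times the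
common mass. Subtracting it does not change their difference, keeps both in the cone and multiplies
the mass by `1 - c`, which becomes the rate. -/
theorem LiftData.exists_coneData {T : UnitAddCircle → UnitAddCircle} (L : LiftData T) :
    ∃ a θ, ConeData T a θ := by
  have hlam := L.one_lt_rate
  have hB := L.distortion_nonneg
  set lam := L.rate
  set B := L.distortion
  have hlam1 : 0 < lam - 1 := by linarith
  -- Chosen so that `(a + B) / lam = a - 1 / lam`, strictly below `a`.
  set a := (B + 1) / (lam - 1) with ha
  have ha0 : 0 < a := by positivity
  have hab : (a + B) / lam = a * (1 - 1 / (lam * a)) := by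
    have h1 : a * (lam - 1) = B + 1 := by rw [ha]; field_simp
    have h2 : 0 < lam := by linarith
    field_simp
    linarith
  set ε := 1 / (lam * a) with hε
  have hε0 : 0 < ε := by positivity
  have hε1 : ε ≤ 1 := by
    have h1 : 0 ≤ (a + B) / lam := by positivity
    rw [hab] at h1
    have := nonneg_of_mul_nonneg_right h1 ha0
    linarith
  have hba : (a + B) / lam ≤ a := by
    rw [hab]
    nlinarith
  have hTm : Measurable T := L.continuous.measurable
  -- A density in the cone is at least `exp (-a)` times its mass, so `ε * exp (-a)` is admissible;
  -- halving it ensures `1 - c > 0`.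
  set c := ε * Real.exp (-a) / 2 with hc
  have hc0 : 0 < c := by positivity
  have hce : c < ε * Real.exp (-a) := by
    have : 0 < ε * Real.exp (-a) := by positivity
    linarith
  have hc1 : c < 1 := by
    have h1 : Real.exp (-a) ≤ 1 := Real.exp_le_one_iff.2 (by linarith)
    have h2 : ε * Real.exp (-a) ≤ 1 := mul_le_one₀ hε1 (Real.exp_pos _).le h1
    linarith
  have hsub : ∀ g, LogLip ((a + B) / lam) g → LogLip a fun x => g x - c * ∫ y, g y := by
    intro g hg
    refine hg.sub_const ha0.le hε0.le hε1 hab.le fun x => ?_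
    have h1 := (hg.mono hba).integral_le ha0.le x
    have h2 : 0 ≤ ∫ y, g y := integral_nonneg hg.1
    calc c * ∫ y, g y ≤ (ε * Real.exp (-a)) * (Real.exp a * g x) :=
          mul_le_mul hce.le h1 h2 (by positivity)
      _ = ε * g x * (Real.exp (-a) * Real.exp a) := by ring
      _ = ε * g x := by rw [← Real.exp_add]; simp
  refine ⟨a, 1 - c, ha0, by linarith, by linarith, hTm, ?_, ?_⟩
  · intro n
    induction n with
    | zero => exact fun f hf => ⟨f, hf, fun u _ _ => rfl⟩
    | succ n ih =>
      intro f hf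
      obtain ⟨g, hg, hgu⟩ := L.exists_transfer ha0.le hf
      obtain ⟨k, hk, hku⟩ := ih g (hg.mono hba)
      refine ⟨k, hk, fun u hu hC => ?_⟩
      rw [← hku u hu hC]
      exact hgu (fun x => u (T^[n] x)) (hu.comp (hTm.iterate n)) (hC.imp fun _ h x => h _)
  · intro n
    induction n with
    | zero =>
      intro f g hf hg hfg u hu hu1
      have hfi := hf.continuous.integrable_unitAddCircle
      have hgi := hg.continuous.integrable_unitAddCircle
      refine (abs_integral_mul_le (fun x => hu1 (T^[0] x)) (hfi.sub hgi)).trans ?_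
      have h1 : ∫ x, |f x - g x| ≤ ∫ x, (f x + g x) := by
        refine integral_mono (hfi.sub hgi).abs (hfi.add hgi) fun x => ?_
        have h1 := hf.1 x
        have h2 := hg.1 x
        exact abs_le.2 ⟨by linarith, by linarith⟩
      rw [integral_add hfi hgi, ← hfg] at h1
      simpa [two_mul] using h1
    | succ n ih =>
      intro f g hf hg hfg u hu hu1
      obtain ⟨f', hf', hfu⟩ := L.exists_transfer ha0.le hf
      obtain ⟨g', hg', hgu⟩ := L.exists_transfer ha0.le hg
      have hfi := hf.continuous.integrable_unitAddCircle
      have hgi := hg.continuous.integrable_unitAddCircle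
      have hfi' := hf'.continuous.integrable_unitAddCircle
      have hgi' := hg'.continuous.integrable_unitAddCircle
      have hf1 : ∫ x, f x = ∫ x, f' x := by
        simpa using hfu (fun _ => 1) measurable_const ⟨1, by simp⟩
      have hg1 : ∫ x, g x = ∫ x, g' x := by
        simpa using hgu (fun _ => 1) measurable_const ⟨1, by simp⟩
      have hf'g' : ∫ x, f' x = ∫ x, g' x := by rw [← hf1, hfg, hg1]
      have hi : ∀ k : UnitAddCircle → ℝ, Integrable k → ∫ x, (k x - c * ∫ y, k y)
          = (1 - c) * ∫ y, k y := by
        intro k hk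
        rw [integral_sub hk (integrable_const _)]
        simp
        ring
      have hv : Measurable fun x => u (T^[n] x) := hu.comp (hTm.iterate n)
      have hv1 : ∀ x, |u (T^[n] x)| ≤ 1 := fun x => hu1 _
      have key := ih _ _ (hsub f' hf') (hsub g' hg')
        (by rw [hi f' hfi', hi g' hgi', hf'g']) u hu hu1
      rw [hi f' hfi', hf'g'] at key
      have e1 : ∫ x, u (T^[n + 1] x) * (f x - g x)
          = ∫ x, u (T^[n] x) * (f' x - c * (∫ y, g' y) - (g' x - c * ∫ y, g' y)) := by
        have hw : Measurable fun x => u (T^[n + 1] x) := hu.comp (hTm.iterate (n + 1))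
        have hw1 : ∀ x, |u (T^[n + 1] x)| ≤ 1 := fun x => hu1 _
        have e2 := hfu _ hv ⟨1, hv1⟩
        have e3 := hgu _ hv ⟨1, hv1⟩
        simp only [sub_sub_sub_cancel_right, mul_sub]
        rw [integral_sub (integrable_bdd_mul hw hw1 hfi) (integrable_bdd_mul hw hw1 hgi),
          integral_sub (integrable_bdd_mul hv hv1 hfi') (integrable_bdd_mul hv hv1 hgi')]
        simp only [Function.iterate_succ_apply] at e2 e3 ⊢
        rw [e2, e3]
      rw [e1, hfg, hg1]
      refine key.trans (le_of_eq ?_)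
      ring

theorem ConeData.decay_lipschitz {T : UnitAddCircle → UnitAddCircle} {a θ : ℝ}
    (H : ConeData T a θ) {K : ℝ} (hK : 0 ≤ K) {φ : UnitAddCircle → ℝ}
    (hφ : ∀ x y, |φ x - φ y| ≤ K * dist x y) {u : UnitAddCircle → ℝ} (hu : Measurable u)
    (hu1 : ∀ x, |u x| ≤ 1) (n : ℕ) :
    |∫ x, u (T^[n] x) * (φ x - ∫ y, φ y)| ≤ 2 * (1 + 1 / a) * K * θ ^ n := by
  have hcont : Continuous φ := by
    refine (LipschitzWith.of_dist_le_mul (K := K.toNNReal) fun x y => ?_).continuous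
    rw [Real.dist_eq, Real.coe_toNNReal _ hK]
    exact hφ x y
  have hint := hcont.integrable_unitAddCircle
  set ψ : UnitAddCircle → ℝ := fun x => φ x - ∫ y, φ y with hψ
  have hψi : Integrable ψ := hint.sub (integrable_const _)
  have hψ0 : ∫ x, ψ x = 0 := by
    rw [hψ, integral_sub hint (integrable_const _)]
    simp
  have hψL : ∀ x y, |ψ x - ψ y| ≤ K * dist x y := fun x y => by simpa [hψ] using hφ x y
  have hψb : ∀ x, |ψ x| ≤ K := by
    intro x
    have h1 : ψ x = ∫ y, (ψ x - ψ y) := by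
      rw [integral_sub (integrable_const (μ := volume) _) hψi, hψ0]
      simp
    rw [h1, ← Real.norm_eq_abs]
    have := norm_integral_le_of_norm_le (f := fun y => ψ x - ψ y) (integrable_const (μ := volume) K)
      (Filter.Eventually.of_forall fun y => (hψL x y).trans
        (mul_le_of_le_one_right hK (dist_le_one x y)))
    simpa using this
  have ha := H.a_pos
  have hM : 0 ≤ K * (1 + 1 / a) := by positivity
  have key := H.decay n _ _ (logLip_of_lipschitz ha hK hψL hψb) (logLip_const ha.le hM)
    (by rw [integral_add hψi (integrable_const _), hψ0, zero_add]) u hu hu1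
  rw [integral_add hψi (integrable_const _), hψ0, zero_add] at key
  simp only [add_sub_cancel_right] at key
  refine key.trans (le_of_eq ?_)
  simp
  ring

/-- The thickened indicator is `δ⁻¹`-Lipschitz, which gives the decaying term; the other term is
twice the mass added by thickening. -/
theorem ConeData.decay_isClosed {T : UnitAddCircle → UnitAddCircle} {a θ : ℝ}
    (H : ConeData T a θ) {A : Set UnitAddCircle} (hA : IsClosed A) {δ : ℝ} (hδ : 0 < δ)
    {u : UnitAddCircle → ℝ} (hu : Measurable u) (hu1 : ∀ x, |u x| ≤ 1) (n : ℕ) :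
    |∫ x, u (T^[n] x) * (A.indicator 1 x - volume.real A)| ≤
      2 * (1 + 1 / a) * δ⁻¹ * θ ^ n +
        2 * ((∫ x, (thickenedIndicator hδ A x : ℝ)) - volume.real A) := by
  set ψ : UnitAddCircle → ℝ := fun x => thickenedIndicator hδ A x with hψ
  have hψi : Integrable ψ := integrable_thickenedIndicator A hδ
  have hAi : Integrable (A.indicator (1 : UnitAddCircle → ℝ)) :=
    (integrable_const 1).indicator hA.measurableSet
  have hAint : ∫ x, A.indicator (1 : UnitAddCircle → ℝ) x = volume.real A :=
    integral_indicator_one hA.measurableSet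
  have hψL : ∀ x y, |ψ x - ψ y| ≤ δ⁻¹ * dist x y := by
    intro x y
    have h := (lipschitzWith_thickenedIndicator hδ A).dist_le_mul x y
    rw [NNReal.dist_eq, NNReal.coe_inv, Real.coe_toNNReal _ hδ.le] at h
    exact h
  have hle : ∀ x, A.indicator (1 : UnitAddCircle → ℝ) x ≤ ψ x := by
    intro x
    by_cases hx : x ∈ A
    · simp only [hx, indicator_of_mem, Pi.one_apply, hψ, thickenedIndicator_one hδ A hx,
        NNReal.coe_one, le_refl]
    · simp [hx, hψ]
  have h1 := H.decay_lipschitz (inv_nonneg.2 hδ.le) hψL hu hu1 n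
  have hv : Measurable fun x => u (T^[n] x) := hu.comp (H.measurable.iterate n)
  have hv1 : ∀ x, |u (T^[n] x)| ≤ 1 := fun x => hu1 _
  set r : UnitAddCircle → ℝ := fun x => ψ x - A.indicator (1 : UnitAddCircle → ℝ) x with hr
  have hri : Integrable r := hψi.sub hAi
  have hrint : ∫ x, r x = (∫ x, ψ x) - volume.real A := by rw [hr, integral_sub hψi hAi, hAint]
  have hr0 : 0 ≤ ∫ x, r x := integral_nonneg fun x => sub_nonneg.2 (hle x)
  have h2 : |∫ x, u (T^[n] x) * (r x - ∫ y, r y)| ≤ 2 * ∫ x, r x := by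
    refine (abs_integral_mul_le hv1 (hri.sub (integrable_const _))).trans ?_
    have : ∫ x, |r x - ∫ y, r y| ≤ ∫ x, (r x + ∫ y, r y) := by
      refine integral_mono (hri.sub (integrable_const _)).abs (hri.add (integrable_const _))
        fun x => ?_
      have h0 : 0 ≤ r x := sub_nonneg.2 (hle x)
      exact abs_le.2 ⟨by linarith, by linarith⟩
    refine this.trans (le_of_eq ?_)
    rw [integral_add hri (integrable_const _)]
    simp
    ring
  have hψi' : Integrable fun x => ψ x - ∫ y, ψ y := hψi.sub (integrable_const _)
  have hri' : Integrable fun x => r x - ∫ y, r y := hri.sub (integrable_const _)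
  have h3 : ∫ x, u (T^[n] x) * (A.indicator 1 x - volume.real A)
      = (∫ x, u (T^[n] x) * (ψ x - ∫ y, ψ y)) - ∫ x, u (T^[n] x) * (r x - ∫ y, r y) := by
    rw [← integral_sub (integrable_bdd_mul hv hv1 hψi')
      (integrable_bdd_mul hv hv1 hri')]
    refine integral_congr_ae (Filter.Eventually.of_forall fun x => ?_)
    beta_reduce
    rw [hrint]
    simp only [hr]
    ring
  rw [h3, ← hrint]
  exact (abs_sub _ _).trans (add_le_add h1 h2)


/-! ### Arcs, integration by parts and decay for `W^{1,1}` densities -/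

theorem integrable_comp_coe {f : UnitAddCircle → ℝ} (hf : Integrable f) :
    IntervalIntegrable (fun t : ℝ => f t) volume 0 1 := by
  rw [intervalIntegrable_iff_integrableOn_Ioc_of_le zero_le_one, IntegrableOn]
  simpa [Function.comp_def] using
    (UnitAddCircle.measurePreserving_mk 0).integrable_comp_of_integrable hf

theorem integral_eq_intervalIntegral (f : UnitAddCircle → ℝ) :
    ∫ x, f x = ∫ t in (0 : ℝ)..1, f t := by
  simpa using (UnitAddCircle.intervalIntegral_preimage 0 f).symm

/-- The arc `[0, x]` of the circle. -/
def arc (x : ℝ) : Set UnitAddCircle := ((↑) : ℝ → UnitAddCircle) '' Icc 0 x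

theorem isClosed_arc (x : ℝ) : IsClosed (arc x) :=
  (isCompact_Icc.image (AddCircle.continuous_mk' 1)).isClosed

theorem coe_mem_arc_iff {x t : ℝ} (hx : x ≤ 1) (ht : t ∈ Ioo (0 : ℝ) 1) :
    (t : UnitAddCircle) ∈ arc x ↔ t ≤ x := by
  refine ⟨?_, fun h => ⟨t, ⟨ht.1.le, h⟩, rfl⟩⟩
  rintro ⟨s, hs, hst⟩
  rcases hs.2.trans hx |>.lt_or_eq with h1 | h1
  · have := (AddCircle.coe_eq_coe_iff_of_mem_Ico (p := (1 : ℝ)) (a := 0)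
      (x := s) (y := t) ⟨hs.1, by simpa using h1⟩ ⟨ht.1.le, by simpa using ht.2⟩).1 hst
    exact this ▸ hs.2
  · exact ht.2.le.trans (h1 ▸ hs.2)

theorem integral_mul_indicator_arc {x : ℝ} (hx : x ∈ Icc (0 : ℝ) 1) (v : UnitAddCircle → ℝ) :
    ∫ y, v y * (arc x).indicator 1 y = ∫ t in (0 : ℝ)..x, v t := by
  rw [integral_eq_intervalIntegral, intervalIntegral.integral_of_le zero_le_one,
    intervalIntegral.integral_of_le hx.1, integral_Ioc_eq_integral_Ioo]
  have : ∫ t in Ioo (0 : ℝ) 1, v t * (arc x).indicator 1 (t : UnitAddCircle)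
      = ∫ t in Ioo (0 : ℝ) 1, (Iic x).indicator (fun t : ℝ => v t) t := by
    refine setIntegral_congr_fun measurableSet_Ioo fun t ht => ?_
    by_cases h : t ≤ x
    · simp [indicator_of_mem ((coe_mem_arc_iff hx.2 ht).2 h), h]
    · simp [indicator_of_notMem (mt (coe_mem_arc_iff hx.2 ht).1 h), h]
  rw [this, ← integral_Ioc_eq_integral_Ioo, setIntegral_indicator measurableSet_Iic]
  congr 2
  ext t
  simp only [mem_inter_iff, mem_Ioc, mem_Iic]
  constructor
  · rintro ⟨h1, h2⟩; exact ⟨h1.1, h2⟩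
  · rintro ⟨h1, h2⟩; exact ⟨⟨h1, h2.trans hx.2⟩, h2⟩

theorem volume_real_arc {x : ℝ} (hx : x ∈ Icc (0 : ℝ) 1) : volume.real (arc x) = x := by
  rw [← integral_indicator_one (isClosed_arc x).measurableSet]
  simpa using integral_mul_indicator_arc hx fun _ => 1

theorem integral_thickenedIndicator_arc_le {x δ : ℝ} (hx : x ∈ Icc (0 : ℝ) 1) (hδ : 0 < δ) :
    ∫ y, (thickenedIndicator hδ (arc x) y : ℝ) ≤ x + 2 * δ := by
  rw [integral_eq_intervalIntegral, intervalIntegral.integral_of_le zero_le_one]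
  set A := Ioc (0 : ℝ) (x + δ)
  set B := Ioc (1 - δ) 1
  have hA : Integrable (A.indicator (1 : ℝ → ℝ)) :=
    (integrable_indicator_iff measurableSet_Ioc).2 (integrableOn_const (by simp))
  have hB : Integrable (B.indicator (1 : ℝ → ℝ)) :=
    (integrable_indicator_iff measurableSet_Ioc).2 (integrableOn_const (by simp))
  have hnn : ∀ (S : Set ℝ) t, (0 : ℝ) ≤ S.indicator 1 t :=
    fun S t => indicator_nonneg (by simp) t
  have h1 : ∫ t in Ioc (0 : ℝ) 1, (thickenedIndicator hδ (arc x) (t : UnitAddCircle) : ℝ)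
      ≤ ∫ t in Ioc (0 : ℝ) 1, (A.indicator 1 t + B.indicator 1 t) := by
    refine setIntegral_mono_on ?_ (hA.add hB).integrableOn measurableSet_Ioc fun t ht => ?_
    · exact (intervalIntegrable_iff_integrableOn_Ioc_of_le zero_le_one).1
        (integrable_comp_coe (integrable_thickenedIndicator (arc x) hδ))
    · have hle : (thickenedIndicator hδ (arc x) (t : UnitAddCircle) : ℝ) ≤ 1 := by
        exact_mod_cast thickenedIndicator_le_one hδ (arc x) _
      by_cases hmem : (t : UnitAddCircle) ∈ Metric.thickening δ (arc x)
      · obtain ⟨z, ⟨s, hs, rfl⟩, hz⟩ := Metric.mem_thickening_iff.1 hmem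
        rw [dist_eq_norm, ← AddCircle.coe_sub, UnitAddCircle.norm_eq, abs_lt] at hz
        by_cases hn : round (t - s) ≤ 0
        · have : ((round (t - s) : ℤ) : ℝ) ≤ 0 := by exact_mod_cast hn
          have : t ∈ A := ⟨ht.1, by linarith [hs.2]⟩
          rw [indicator_of_mem this]
          have := hnn B t
          simp only [Pi.one_apply]
          linarith
        · have : (1 : ℝ) ≤ ((round (t - s) : ℤ) : ℝ) := by
            exact_mod_cast (by omega : 1 ≤ round (t - s))
          have : t ∈ B := ⟨by linarith [hs.1], ht.2⟩
          rw [indicator_of_mem this]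
          have := hnn A t
          simp only [Pi.one_apply]
          linarith
      · rw [thickenedIndicator_zero hδ _ hmem]
        exact add_nonneg (hnn A t) (hnn B t)
  have h2 : ∫ t in Ioc (0 : ℝ) 1, (A.indicator 1 t + B.indicator 1 t : ℝ)
      ≤ ∫ t, (A.indicator 1 t + B.indicator 1 t : ℝ) :=
    setIntegral_le_integral (hA.add hB)
      (Filter.Eventually.of_forall fun t => add_nonneg (hnn A t) (hnn B t))
  rw [integral_add hA hB, integral_indicator_one measurableSet_Ioc,
    integral_indicator_one measurableSet_Ioc, Real.volume_real_Ioc_of_le (by linarith [hx.1]),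
    Real.volume_real_Ioc_of_le (by linarith)] at h2
  linarith

/-- The left side is the correlation with the arc `[0, x]`. Taking `δ = √θ ^ n` balances `δ⁻¹ * θ ^
n` against the thickening error `4 * δ`. -/
theorem ConeData.abs_sub_le {T : UnitAddCircle → UnitAddCircle} {a θ : ℝ}
    (H : ConeData T a θ) {u : UnitAddCircle → ℝ} (hu : Measurable u) (hu1 : ∀ x, |u x| ≤ 1)
    (n : ℕ) {x : ℝ} (hx : x ∈ Icc (0 : ℝ) 1) :
    |(∫ t in (0 : ℝ)..x, u (T^[n] t)) - x * ∫ t in (0 : ℝ)..1, u (T^[n] t)| ≤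
      (2 * (1 + 1 / a) + 4) * √θ ^ n := by
  have hθ := H.θ_pos
  have ha := H.a_pos
  have hδ : 0 < √θ ^ n := by positivity
  have h1 := H.decay_isClosed (isClosed_arc x) hδ hu hu1 n
  have h2 := integral_thickenedIndicator_arc_le hx hδ
  have hv : Measurable fun x => u (T^[n] x) := hu.comp (H.measurable.iterate n)
  have hv1 : ∀ x, |u (T^[n] x)| ≤ 1 := fun x => hu1 _
  rw [volume_real_arc hx] at h1
  simp only [mul_sub] at h1
  rw [integral_sub (integrable_bdd_mul (f := (arc x).indicator 1) hv hv1
    ((integrable_const 1).indicator (isClosed_arc x).measurableSet)) (integrable_bdd_mul hv hv1 (integrable_const x)),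
    integral_mul_const, integral_mul_indicator_arc hx fun x => u (T^[n] x),
    integral_eq_intervalIntegral, mul_comm _ x] at h1
  have h3 : (√θ ^ n)⁻¹ * θ ^ n = √θ ^ n := by
    rw [inv_mul_eq_iff_eq_mul₀ hδ.ne', ← mul_pow, Real.mul_self_sqrt hθ.le]
  rw [mul_assoc _ _ (θ ^ n), h3] at h1
  linarith

theorem integral_mul_eq_of_hasL1Deriv {f f' v : UnitAddCircle → ℝ} (hf : HasL1Deriv f f')
    {C : ℝ} (hv : Measurable v) (hvC : ∀ x, |v x| ≤ C) :
    ∫ x, v x * f x = f 0 * (∫ t in (0 : ℝ)..1, v t) -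
      ∫ t in (0 : ℝ)..1, f' t * ∫ s in (0 : ℝ)..t, v s := by
  have hf' := integrable_comp_coe hf.1
  have hvi : IntervalIntegrable (fun t : ℝ => v t) volume 0 1 :=
    integrable_comp_coe (Integrable.of_bound hv.aestronglyMeasurable C
      (Filter.Eventually.of_forall hvC))
  set F : ℝ → ℝ := fun x => ∫ t in (0 : ℝ)..x, f' t with hF
  set V : ℝ → ℝ := fun x => ∫ t in (0 : ℝ)..x, v t with hV
  have hFac : AbsolutelyContinuousOnInterval F 0 1 :=
    hf'.absolutelyContinuousOnInterval_intervalIntegral (by simp)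
  have hVac : AbsolutelyContinuousOnInterval V 0 1 :=
    hvi.absolutelyContinuousOnInterval_intervalIntegral (by simp)
  have hdF : ∀ᵐ t : ℝ, t ∈ uIoc (0 : ℝ) 1 → deriv F t = f' t := by
    filter_upwards [hf'.ae_hasDerivAt_integral] with t ht hmem
    exact (ht (uIoc_subset_uIcc hmem) 0 (by simp)).deriv
  have hdV : ∀ᵐ t : ℝ, t ∈ uIoc (0 : ℝ) 1 → deriv V t = v t := by
    filter_upwards [hvi.ae_hasDerivAt_integral] with t ht hmem
    exact (ht (uIoc_subset_uIcc hmem) 0 (by simp)).deriv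
  -- Periodicity of `f` removes the boundary term at 1.
  have hF1 : F 1 = 0 := by
    have h1 := hf.2 1 (by simp)
    have h2 : ((1 : ℝ) : UnitAddCircle) = 0 := AddCircle.coe_period 1
    rw [h2] at h1
    simp only [hF]
    linarith
  have hF0 : F 0 = 0 := by simp [hF]
  have parts := hFac.integral_mul_deriv_eq_deriv_mul hVac
  rw [hF1, hF0, zero_mul, zero_mul, sub_zero, zero_sub] at parts
  have e1 : ∫ t in (0 : ℝ)..1, F t * deriv V t = ∫ t in (0 : ℝ)..1, F t * v t :=
    intervalIntegral.integral_congr_ae (by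
      filter_upwards [hdV] with t ht hmem
      rw [ht hmem])
  have e2 : ∫ t in (0 : ℝ)..1, deriv F t * V t = ∫ t in (0 : ℝ)..1, f' t * V t :=
    intervalIntegral.integral_congr_ae (by
      filter_upwards [hdF] with t ht hmem
      rw [ht hmem])
  rw [e1, e2] at parts
  rw [integral_eq_intervalIntegral]
  have e3 : ∫ t in (0 : ℝ)..1, v t * f t = ∫ t in (0 : ℝ)..1, (f 0 * v t + F t * v t) := by
    refine intervalIntegral.integral_congr fun t ht => ?_
    rw [uIcc_of_le zero_le_one] at ht
    simp only [hf.2 t ht, hF]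
    ring
  rw [e3, intervalIntegral.integral_add (hvi.const_mul _) (hvi.continuousOn_mul hFac.continuousOn),
    intervalIntegral.integral_const_mul, parts]
  ring

/-- With `V t = ∫_0^t u ∘ T^n`, integration by parts and the zero mean of `f`, which reads `f 0 = ∫
t f' t`, turn the integral into `-∫ f' t (V t - t V 1)`. The bracket is the correlation with an arc,
bounded uniformly in `t`. -/
theorem ConeData.decay_of_hasL1Deriv {T : UnitAddCircle → UnitAddCircle} {a θ : ℝ}
    (H : ConeData T a θ) {f f' : UnitAddCircle → ℝ} (hf : HasL1Deriv f f') (h0 : ∫ x, f x = 0)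
    {u : UnitAddCircle → ℝ} (hu : Measurable u) (hu1 : ∀ x, |u x| ≤ 1) (n : ℕ) :
    |∫ x, u (T^[n] x) * f x| ≤ (2 * (1 + 1 / a) + 4) * √θ ^ n * ∫ x, |f' x| := by
  have hv : Measurable fun x => u (T^[n] x) := hu.comp (H.measurable.iterate n)
  have hv1 : ∀ x, |u (T^[n] x)| ≤ 1 := fun x => hu1 _
  have hf' := integrable_comp_coe hf.1
  have hvi : IntervalIntegrable (fun t : ℝ => u (T^[n] t)) volume 0 1 :=
    integrable_comp_coe (Integrable.of_bound hv.aestronglyMeasurable 1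
      (Filter.Eventually.of_forall hv1))
  have e1 := integral_mul_eq_of_hasL1Deriv hf hv hv1
  have e2 := integral_mul_eq_of_hasL1Deriv hf (v := fun _ => 1) measurable_const (C := 1) (by simp)
  simp only [one_mul, h0, intervalIntegral.integral_const, sub_zero, smul_eq_mul, mul_one] at e2
  have hVc : ContinuousOn (fun t => ∫ s in (0 : ℝ)..t, u (T^[n] s)) (uIcc (0 : ℝ) 1) :=
    (hvi.absolutelyContinuousOnInterval_intervalIntegral (c := 0) (by simp)).continuousOn
  have e3 : ∫ x, u (T^[n] x) * f x = -∫ t in (0 : ℝ)..1, f' t *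
      ((∫ s in (0 : ℝ)..t, u (T^[n] s)) - t * ∫ s in (0 : ℝ)..1, u (T^[n] s)) := by
    rw [e1, show f 0 = ∫ t in (0 : ℝ)..1, f' t * t by linarith,
      ← intervalIntegral.integral_mul_const, ← intervalIntegral.integral_sub,
      ← intervalIntegral.integral_neg]
    · refine intervalIntegral.integral_congr fun t _ => ?_
      ring
    · exact (hf'.mul_continuousOn continuousOn_id).mul_const _
    · exact hf'.mul_continuousOn hVc
  rw [e3, abs_neg]
  refine (intervalIntegral.abs_integral_le_integral_abs zero_le_one).trans ?_
  rw [integral_eq_intervalIntegral, ← intervalIntegral.integral_const_mul]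
  refine intervalIntegral.integral_mono_on zero_le_one ?_ (hf'.abs.const_mul _) fun t ht => ?_
  · exact (hf'.mul_continuousOn (hVc.sub (continuousOn_id.mul continuousOn_const))).abs
  · rw [abs_mul, mul_comm]
    exact mul_le_mul_of_nonneg_right (H.abs_sub_le hu hu1 n ht) (abs_nonneg _)

/-! ### Mixing of integrable densities, without a rate -/

/-- The correlations of `φ` with all observables of norm at most one tend to zero uniformly. -/
def Mixes (T : UnitAddCircle → UnitAddCircle) (φ : UnitAddCircle → ℝ) : Prop :=
  ∀ ε > 0, ∃ N, ∀ n ≥ N, ∀ u : UnitAddCircle → ℝ, Measurable u → (∀ x, |u x| ≤ 1) →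
    |∫ x, u (T^[n] x) * (φ x - ∫ y, φ y)| ≤ ε

theorem abs_integral_sub_mean_le {v φ : UnitAddCircle → ℝ} (hv1 : ∀ x, |v x| ≤ 1)
    (hφ : Integrable φ) : |∫ x, v x * (φ x - ∫ y, φ y)| ≤ 2 * ∫ x, |φ x| := by
  have h0 : Integrable fun x => φ x - ∫ y, φ y := hφ.sub (integrable_const _)
  refine (abs_integral_mul_le hv1 h0).trans ?_
  have h1 : ∫ x, |φ x - ∫ y, φ y| ≤ ∫ x, (|φ x| + ∫ y, |φ y|) := by
    refine integral_mono h0.abs (hφ.abs.add (integrable_const _))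
      fun x => ?_
    exact (abs_sub _ _).trans (add_le_add le_rfl abs_integral_le_integral_abs)
  rw [integral_add hφ.abs (integrable_const _)] at h1
  simp only [integral_const, probReal_univ, smul_eq_mul, one_mul] at h1
  linarith

theorem integral_mul_sub_mean_add {v φ ψ : UnitAddCircle → ℝ} (hv : Measurable v)
    (hv1 : ∀ x, |v x| ≤ 1) (hφ : Integrable φ) (hψ : Integrable ψ) :
    ∫ x, v x * ((φ + ψ) x - ∫ y, (φ + ψ) y) =
      (∫ x, v x * (φ x - ∫ y, φ y)) + ∫ x, v x * (ψ x - ∫ y, ψ y) := by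
  have h1 : Integrable fun x => φ x - ∫ y, φ y := hφ.sub (integrable_const _)
  have h2 : Integrable fun x => ψ x - ∫ y, ψ y := hψ.sub (integrable_const _)
  rw [← integral_add (integrable_bdd_mul hv hv1 h1) (integrable_bdd_mul hv hv1 h2)]
  simp only [Pi.add_apply]
  rw [integral_add hφ hψ]
  refine integral_congr_ae (Filter.Eventually.of_forall fun x => ?_)
  simp only
  ring

/-- Replacing `φ` by `ψ` costs at most `2 ‖φ - ψ‖_1`, whatever `n` and `u` are. -/
theorem Mixes.of_approx {T : UnitAddCircle → UnitAddCircle} (hT : Measurable T)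
    {φ : UnitAddCircle → ℝ} (hφ : Integrable φ)
    (h : ∀ ε > 0, ∃ ψ, Integrable ψ ∧ Mixes T ψ ∧ ∫ x, |φ x - ψ x| ≤ ε) : Mixes T φ := by
  intro ε hε
  obtain ⟨ψ, hψ, hm, hle⟩ := h (ε / 4) (by positivity)
  obtain ⟨N, hN⟩ := hm (ε / 2) (by positivity)
  refine ⟨N, fun n hn u hu hu1 => ?_⟩
  have hv : Measurable fun x => u (T^[n] x) := hu.comp (hT.iterate n)
  have hv1 : ∀ x, |u (T^[n] x)| ≤ 1 := fun x => hu1 _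
  have h1 := integral_mul_sub_mean_add hv hv1 hψ (hφ.sub hψ)
  rw [add_sub_cancel] at h1
  rw [h1]
  have h2 := abs_integral_sub_mean_le hv1 (hφ.sub hψ)
  have h3 := hN n hn u hu hu1
  simp only [Pi.sub_apply] at h2 ⊢
  have := abs_add_le (∫ x, u (T^[n] x) * (ψ x - ∫ y, ψ y))
    (∫ x, u (T^[n] x) * (φ x - ψ x - ∫ y, (φ y - ψ y)))
  linarith

theorem ConeData.mixes_indicator_isClosed {T : UnitAddCircle → UnitAddCircle} {a θ : ℝ}
    (H : ConeData T a θ) {A : Set UnitAddCircle} (hA : IsClosed A) :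
    Mixes T (A.indicator 1) := by
  intro ε hε
  obtain ⟨k, hk⟩ : ∃ k : ℕ, 2 * ((∫ x, (thickenedIndicator (δ := 1 / ((k : ℝ) + 1))
      Nat.one_div_pos_of_nat A x : ℝ)) - volume.real A) < ε / 2 := by
    have h1 := tendsto_integral_thickenedIndicator_of_isClosed (volume : Measure UnitAddCircle) hA
      (fun n : ℕ => Nat.one_div_pos_of_nat (α := ℝ)) tendsto_one_div_add_atTop_nhds_zero_nat
    have h2 := (h1.sub_const (volume.real A)).const_mul 2
    rw [sub_self, mul_zero] at h2
    exact (h2.eventually (gt_mem_nhds (by positivity : 0 < ε / 2))).exists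
  set δ : ℝ := 1 / ((k : ℝ) + 1)
  have h3 : Filter.Tendsto (fun n => 2 * (1 + 1 / a) * δ⁻¹ * θ ^ n) Filter.atTop (nhds 0) := by
    simpa using (tendsto_pow_atTop_nhds_zero_of_lt_one H.θ_pos.le H.θ_lt).const_mul
      (2 * (1 + 1 / a) * δ⁻¹)
  obtain ⟨N, hN⟩ := Filter.eventually_atTop.1
    (h3.eventually (gt_mem_nhds (by positivity : 0 < ε / 2)))
  refine ⟨N, fun n hn u hu hu1 => ?_⟩
  rw [integral_indicator_one hA.measurableSet]
  refine (H.decay_isClosed hA (Nat.one_div_pos_of_nat (n := k)) hu hu1 n).trans ?_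
  have := hN n hn
  linarith

theorem Mixes.const_mul {T : UnitAddCircle → UnitAddCircle} {φ : UnitAddCircle → ℝ}
    (h : Mixes T φ) (c : ℝ) : Mixes T fun x => c * φ x := by
  intro ε hε
  obtain ⟨N, hN⟩ := h (ε / (|c| + 1)) (by positivity)
  refine ⟨N, fun n hn u hu hu1 => ?_⟩
  have h1 : ∫ x, u (T^[n] x) * (c * φ x - ∫ y, c * φ y)
      = c * ∫ x, u (T^[n] x) * (φ x - ∫ y, φ y) := by
    rw [← integral_const_mul, integral_const_mul]
    refine integral_congr_ae (Filter.Eventually.of_forall fun x => ?_)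
    simp only
    ring
  rw [h1, abs_mul]
  have h2 := hN n hn u hu hu1
  rw [le_div_iff₀ (by positivity)] at h2
  nlinarith [abs_nonneg c, abs_nonneg (∫ x, u (T^[n] x) * (φ x - ∫ y, φ y))]

theorem ConeData.mixes {T : UnitAddCircle → UnitAddCircle} {a θ : ℝ}
    (H : ConeData T a θ) {φ : UnitAddCircle → ℝ} (hφ : Integrable φ) : Mixes T φ := by
  refine Integrable.induction (Mixes T) ?_ ?_ ?_ ?_ hφ
  · intro c s hs _
    have h1 : Mixes T (s.indicator 1) := by
      refine Mixes.of_approx H.measurable ((integrable_const 1).indicator hs) fun ε hε => ?_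
      obtain ⟨A, hAs, hA, hlt⟩ := hs.exists_isClosed_sdiff_lt (measure_ne_top volume s)
        (ENNReal.ofReal_pos.2 hε).ne'
      refine ⟨A.indicator 1, (integrable_const 1).indicator hA.measurableSet,
        H.mixes_indicator_isClosed hA, ?_⟩
      have h2 : ∀ x, |s.indicator (1 : UnitAddCircle → ℝ) x - A.indicator 1 x|
          = (s \ A).indicator 1 x := by
        intro x
        by_cases hxA : x ∈ A
        · simp [hxA, hAs hxA]
        · by_cases hxs : x ∈ s <;> simp [hxA, hxs]
      simp only [h2]
      rw [integral_indicator_one (hs.diff hA.measurableSet)]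
      exact ENNReal.toReal_le_of_le_ofReal hε.le hlt.le
    have h2 := h1.const_mul c
    convert h2 using 1
    ext x
    by_cases hx : x ∈ s <;> simp [hx]
  · intro f g _ hf hg hPf hPg ε hε
    obtain ⟨N, hN⟩ := hPf (ε / 2) (by positivity)
    obtain ⟨M, hM⟩ := hPg (ε / 2) (by positivity)
    refine ⟨max N M, fun n hn u hu hu1 => ?_⟩
    rw [integral_mul_sub_mean_add (v := fun x => u (T^[n] x)) (hu.comp (H.measurable.iterate n))
      (fun x => hu1 _) hf hg]
    refine (abs_add_le _ _).trans ?_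
    have h1 := hN n (le_of_max_le_left hn) u hu hu1
    have h2 := hM n (le_of_max_le_right hn) u hu hu1
    linarith
  · refine isClosed_of_closure_subset fun f hf => ?_
    refine Mixes.of_approx H.measurable (L1.integrable_coeFn f) fun ε hε => ?_
    obtain ⟨g, hg, hdist⟩ := Metric.mem_closure_iff.1 hf ε hε
    refine ⟨g, L1.integrable_coeFn g, hg, ?_⟩
    rw [dist_eq_norm, L1.norm_eq_integral_norm] at hdist
    refine (le_of_eq (integral_congr_ae ?_)).trans hdist.le
    filter_upwards [Lp.coeFn_sub f g] with x hx
    rw [hx, Pi.sub_apply, Real.norm_eq_abs]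
  · intro f g hfg _ hPf ε hε
    obtain ⟨N, hN⟩ := hPf ε hε
    refine ⟨N, fun n hn u hu hu1 => ?_⟩
    rw [← integral_congr_ae hfg, ← integral_congr_ae (μ := volume)
      (f := fun x => u (T^[n] x) * (f x - ∫ y, f y))]
    · exact hN n hn u hu hu1
    · filter_upwards [hfg] with x hx
      rw [hx]


/-! ### Signed measures as differences of positive measures -/

/-- The integral of `h` against the signed measure `μ`. -/
def signedIntegral (μ : SignedMeasure SolidTorus) (h : SolidTorus → ℝ) : ℝ :=
  ∫ p, h p ∂(pos μ) - ∫ p, h p ∂(neg μ)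

/-- `μ = ν₁ - ν₂`. -/
def IsDiff (μ : SignedMeasure SolidTorus) (ν₁ ν₂ : Measure SolidTorus) : Prop :=
  ∀ E, MeasurableSet E → μ E = ν₁.real E - ν₂.real E

theorem isDiff_pos_neg (μ : SignedMeasure SolidTorus) : IsDiff μ (pos μ) (neg μ) :=
  fun _ hE => μ.apply_eq_posPart_real_sub_negPart_real hE

theorem eq_of_isDiff {μ μ' : SignedMeasure SolidTorus} {ν₁ ν₂ : Measure SolidTorus}
    (h : IsDiff μ ν₁ ν₂) (h' : IsDiff μ' ν₁ ν₂) : μ = μ' :=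
  VectorMeasure.ext fun E hE => (h E hE).trans (h' E hE).symm

theorem IsDiff.pos_add {μ : SignedMeasure SolidTorus} {ν₁ ν₂ : Measure SolidTorus}
    [IsFiniteMeasure ν₁] [IsFiniteMeasure ν₂] (h : IsDiff μ ν₁ ν₂) :
    pos μ + ν₂ = ν₁ + neg μ := by
  ext E hE
  have h1 := h E hE
  rw [isDiff_pos_neg μ E hE] at h1
  rw [← measureReal_eq_measureReal_iff, measureReal_add_apply, measureReal_add_apply]
  linarith

theorem IsDiff.signedIntegral_eq {μ : SignedMeasure SolidTorus} {ν₁ ν₂ : Measure SolidTorus}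
    [IsFiniteMeasure ν₁] [IsFiniteMeasure ν₂] (h : IsDiff μ ν₁ ν₂) {f : SolidTorus → ℝ}
    (hf : Measurable f) {C : ℝ} (hC : ∀ p, |f p| ≤ C) :
    signedIntegral μ f = ∫ p, f p ∂ν₁ - ∫ p, f p ∂ν₂ := by
  have hi : ∀ (ν : Measure SolidTorus) [IsFiniteMeasure ν], Integrable f ν := fun ν _ =>
    Integrable.of_bound hf.aestronglyMeasurable C (Filter.Eventually.of_forall hC)
  have h1 := congrArg (fun ν => ∫ p, f p ∂ν) h.pos_add
  simp only [integral_add_measure (hi (pos μ)) (hi ν₂), integral_add_measure (hi ν₁) (hi (neg μ))]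
    at h1
  unfold signedIntegral
  linarith

theorem mutuallySingular_pos_neg (μ : SignedMeasure SolidTorus) : pos μ ⟂ₘ neg μ :=
  μ.toJordanDecomposition.mutuallySingular

/-- Minimality of the Jordan decomposition: `m₁` is carried by a set on which `m₂` vanishes. This is
what controls `(L_F μ)^±`, because the images of `μ^±` need not be mutually singular. -/
theorem le_of_add_eq_add {α : Type*} [MeasurableSpace α] {m₁ m₂ ν₁ ν₂ : Measure α}
    (hs : m₁ ⟂ₘ m₂) (h : m₁ + ν₂ = ν₁ + m₂) : m₁ ≤ ν₁ := by
  obtain ⟨S, hS, h1, h2⟩ := hs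
  refine Measure.le_iff.2 fun E hE => ?_
  have h3 : m₁ E ≤ m₁ (E ∩ Sᶜ) := by
    refine (measure_mono (t := E ∩ Sᶜ ∪ S) fun x hx => ?_).trans ((measure_union_le _ _).trans ?_)
    · by_cases hxS : x ∈ S
      · exact Or.inr hxS
      · exact Or.inl ⟨hx, hxS⟩
    · rw [h1, add_zero]
  have h4 : m₁ (E ∩ Sᶜ) ≤ (ν₁ + m₂) (E ∩ Sᶜ) := by
    rw [← h]
    exact Measure.le_add_right le_rfl _
  rw [Measure.add_apply, measure_mono_null inter_subset_right h2, add_zero] at h4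
  exact h3.trans (h4.trans (measure_mono inter_subset_left))

theorem IsDiff.pos_le {μ : SignedMeasure SolidTorus} {ν₁ ν₂ : Measure SolidTorus}
    [IsFiniteMeasure ν₁] [IsFiniteMeasure ν₂] (h : IsDiff μ ν₁ ν₂) : pos μ ≤ ν₁ :=
  le_of_add_eq_add (mutuallySingular_pos_neg μ) h.pos_add

theorem IsDiff.neg_le {μ : SignedMeasure SolidTorus} {ν₁ ν₂ : Measure SolidTorus}
    [IsFiniteMeasure ν₁] [IsFiniteMeasure ν₂] (h : IsDiff μ ν₁ ν₂) : neg μ ≤ ν₂ :=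
  le_of_add_eq_add (mutuallySingular_pos_neg μ).symm (ν₂ := ν₁)
    (by rw [add_comm, ← h.pos_add, add_comm])

theorem fst_absolutelyContinuous_of_le {ν ν' : Measure SolidTorus} (h : ν ≤ ν')
    (h' : ν'.fst ≪ volume) : ν.fst ≪ volume :=
  (Measure.map_mono h measurable_fst).absolutelyContinuous.trans h'

theorem IsDiff.isAB {μ : SignedMeasure SolidTorus} {ν₁ ν₂ : Measure SolidTorus}
    [IsFiniteMeasure ν₁] [IsFiniteMeasure ν₂] (h : IsDiff μ ν₁ ν₂) (h₁ : ν₁.fst ≪ volume)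
    (h₂ : ν₂.fst ≪ volume) : IsAB μ :=
  ⟨fst_absolutelyContinuous_of_le h.pos_le h₁, fst_absolutelyContinuous_of_le h.neg_le h₂⟩

theorem isDiff_transfer {F : SolidTorus → SolidTorus} (hF : Measurable F)
    {μ : SignedMeasure SolidTorus} {ν₁ ν₂ : Measure SolidTorus} (h : IsDiff μ ν₁ ν₂) :
    IsDiff (transfer F μ) (ν₁.map F) (ν₂.map F) := by
  intro E hE
  rw [transfer, VectorMeasure.map_apply _ hF hE, h _ (hF hE), map_measureReal_apply hF hE,
    map_measureReal_apply hF hE]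

theorem signedIntegral_transfer {F : SolidTorus → SolidTorus} (hF : Measurable F)
    (μ : SignedMeasure SolidTorus) {h : SolidTorus → ℝ} (hh : Measurable h) {C : ℝ}
    (hC : ∀ p, |h p| ≤ C) :
    signedIntegral (transfer F μ) h = signedIntegral μ (h ∘ F) := by
  rw [(isDiff_transfer hF (isDiff_pos_neg μ)).signedIntegral_eq hh hC,
    integral_map hF.aemeasurable hh.aestronglyMeasurable,
    integral_map hF.aemeasurable hh.aestronglyMeasurable]
  rfl

theorem signedIntegral_iterate_transfer {F : SolidTorus → SolidTorus} (hF : Measurable F) (n : ℕ)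
    (μ : SignedMeasure SolidTorus) {h : SolidTorus → ℝ} (hh : Measurable h) {C : ℝ}
    (hC : ∀ p, |h p| ≤ C) :
    signedIntegral ((transfer F)^[n] μ) h = signedIntegral μ (h ∘ F^[n]) := by
  induction n generalizing μ with
  | zero => rfl
  | succ n ih =>
    rw [Function.iterate_succ_apply, ih, signedIntegral_transfer hF μ (hh.comp (hF.iterate n))
      (fun p => hC _)]
    rfl

/-! ### Duality between the weak norm and test functions -/

/-- `h` is bounded by `c` and `c`-Lipschitz along the leaves. -/
structure IsTest (c : ℝ) (h : SolidTorus → ℝ) : Prop where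
  measurable : Measurable h
  abs_le : ∀ p, |h p| ≤ c
  lip : ∀ x y₁ y₂, |h (x, y₁) - h (x, y₂)| ≤ c * dist y₁ y₂

theorem integrable_of_bounded {α : Type*} [MeasurableSpace α] {ν : Measure α} [IsFiniteMeasure ν]
    {h : α → ℝ} (hh : Measurable h) {C : ℝ} (hC : ∀ p, |h p| ≤ C) : Integrable h ν :=
  Integrable.of_bound hh.aestronglyMeasurable C (Filter.Eventually.of_forall hC)

theorem measurable_integral_leaf (ν : Measure SolidTorus) [IsFiniteMeasure ν] {h : SolidTorus → ℝ}
    (hh : Measurable h) : Measurable fun γ => ∫ y, h (γ, y) ∂(leaf ν γ) := by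
  unfold leaf
  simp only [integral_smul_measure]
  exact (Measure.measurable_rnDeriv _ _).ennreal_toReal.smul
    hh.stronglyMeasurable.integral_kernel_prod_right'.measurable

theorem integral_leaf (ν : Measure SolidTorus) [IsFiniteMeasure ν] (hν : ν.fst ≪ volume)
    {h : SolidTorus → ℝ} (hh : Measurable h) {C : ℝ} (hC : ∀ p, |h p| ≤ C) :
    Integrable (fun γ => ∫ y, h (γ, y) ∂(leaf ν γ)) ∧
      ∫ γ, ∫ y, h (γ, y) ∂(leaf ν γ) = ∫ p, h p ∂ν := by
  unfold leaf
  simp only [integral_smul_measure]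
  have hi : Integrable h (ν.fst.compProd ν.condKernel) := integrable_of_bounded hh hC
  refine ⟨(integrable_rnDeriv_smul_iff hν).2 ?_, ?_⟩
  · refine integrable_of_bounded (C := C)
      hh.stronglyMeasurable.integral_kernel_prod_right'.measurable fun γ => ?_
    have := norm_integral_le_of_norm_le_const (μ := ν.condKernel γ) (f := fun y => h (γ, y))
      (C := C) (Filter.Eventually.of_forall fun y => hC _)
    simpa using this
  · rw [integral_rnDeriv_smul hν, ← Measure.integral_compProd hi, ν.disintegrate ν.condKernel]

theorem ae_isFiniteMeasure_leaf (ν : Measure SolidTorus) [IsFiniteMeasure ν] :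
    ∀ᵐ γ : UnitAddCircle, IsFiniteMeasure (leaf ν γ) := by
  filter_upwards [Measure.rnDeriv_lt_top ν.fst volume] with γ hγ
  refine ⟨?_⟩
  rw [leaf, Measure.smul_apply, measure_univ, smul_eq_mul, mul_one]
  exact hγ

theorem le_weakNorm {μ : SignedMeasure SolidTorus} (hμ : IsAB μ) {h : SolidTorus → ℝ}
    (hh : IsTest 1 h) : ENNReal.ofReal |signedIntegral μ h| ≤ weakNorm μ := by
  obtain ⟨i1, e1⟩ := integral_leaf (pos μ) hμ.1 hh.measurable hh.abs_le
  obtain ⟨i2, e2⟩ := integral_leaf (neg μ) hμ.2 hh.measurable hh.abs_le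
  rw [signedIntegral, ← e1, ← e2, ← integral_sub i1 i2, ← Real.norm_eq_abs, ofReal_norm]
  refine (enorm_integral_le_lintegral_enorm _).trans (lintegral_mono fun γ => ?_)
  rw [Real.enorm_eq_ofReal_abs]
  refine le_iSup_of_le (fun y => h (γ, y)) (le_iSup_of_le ?_ (le_iSup_of_le ?_ le_rfl))
  · exact LipschitzWith.of_dist_le_mul fun y₁ y₂ => by
      simpa [Real.dist_eq] using hh.lip γ y₁ y₂
  · exact fun y => hh.abs_le _

theorem signedIntegral_const_mul (μ : SignedMeasure SolidTorus) (c : ℝ) (h : SolidTorus → ℝ) :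
    signedIntegral μ (fun p => c * h p) = c * signedIntegral μ h := by
  simp only [signedIntegral, integral_const_mul]
  ring

theorem abs_signedIntegral_le {μ : SignedMeasure SolidTorus} (hμ : μ ∈ spaceL1) {c : ℝ}
    (hc : 0 < c) {h : SolidTorus → ℝ} (hh : IsTest c h) :
    |signedIntegral μ h| ≤ c * (weakNorm μ).toReal := by
  have h1 : IsTest 1 fun p => c⁻¹ * h p := by
    refine ⟨hh.measurable.const_mul _, fun p => ?_, fun x y₁ y₂ => ?_⟩
    · rw [abs_mul, abs_of_pos (inv_pos.2 hc), inv_mul_le_iff₀ hc, mul_one]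
      exact hh.abs_le p
    · rw [← mul_sub, abs_mul, abs_of_pos (inv_pos.2 hc), inv_mul_le_iff₀ hc, one_mul]
      exact hh.lip x y₁ y₂
  have h2 := (ENNReal.ofReal_le_iff_le_toReal hμ.2.ne).1 (le_weakNorm hμ.1 h1)
  rwa [signedIntegral_const_mul, abs_mul, abs_of_pos (inv_pos.2 hc), inv_mul_le_iff₀ hc] at h2

/-- The functions on the disc over which the supremum defining `wasserstein` ranges. -/
def lipBall : Set C(Disc, ℝ) := {g | LipschitzWith 1 g ∧ ∀ y, |g y| ≤ 1}

instance : Nonempty lipBall := ⟨⟨0, LipschitzWith.const 0 |>.weaken zero_le_one, by simp⟩⟩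

/-- Passing to a countable family makes the supremum measurable in the leaf. The absolute value can
be dropped since the family's closure is stable under `g ↦ -g`. -/
theorem wasserstein_le_iSup_denseSeq (ν₁ ν₂ : Measure Disc) [IsFiniteMeasure ν₁]
    [IsFiniteMeasure ν₂] :
    wasserstein ν₁ ν₂ ≤ ⨆ n, ENNReal.ofReal
      (∫ y, (TopologicalSpace.denseSeq lipBall n : C(Disc, ℝ)) y ∂ν₁ -
        ∫ y, (TopologicalSpace.denseSeq lipBall n : C(Disc, ℝ)) y ∂ν₂) := by
  have hint : ∀ (ν : Measure Disc) [IsFiniteMeasure ν] (g : C(Disc, ℝ)), Integrable g ν :=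
    fun ν _ g => g.continuous.integrable_of_hasCompactSupport (HasCompactSupport.of_compactSpace _)
  have hlip : ∀ (ν : Measure Disc) [IsFiniteMeasure ν],
      Continuous fun g : lipBall => ∫ y, (g : C(Disc, ℝ)) y ∂ν := by
    intro ν _
    refine (LipschitzWith.of_dist_le_mul (K := (ν univ).toNNReal) fun g g' => ?_).continuous
    rw [dist_eq_norm, ← integral_sub (hint ν _) (hint ν _)]
    have := norm_integral_le_of_norm_le_const (μ := ν)
      (f := fun y => (g : C(Disc, ℝ)) y - (g' : C(Disc, ℝ)) y) (C := dist g g')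
      (Filter.Eventually.of_forall fun y => by
        rw [← dist_eq_norm]
        exact ContinuousMap.dist_apply_le_dist y)
    rw [mul_comm]
    exact this
  set S := ⨆ n, ENNReal.ofReal
      (∫ y, (TopologicalSpace.denseSeq lipBall n : C(Disc, ℝ)) y ∂ν₁ -
        ∫ y, (TopologicalSpace.denseSeq lipBall n : C(Disc, ℝ)) y ∂ν₂)
  have key : ∀ g : lipBall,
      ENNReal.ofReal (∫ y, (g : C(Disc, ℝ)) y ∂ν₁ - ∫ y, (g : C(Disc, ℝ)) y ∂ν₂) ≤ S := by
    intro g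
    refine (TopologicalSpace.denseRange_denseSeq lipBall).induction_on g ?_ fun n => ?_
    · exact isClosed_le (ENNReal.continuous_ofReal.comp ((hlip ν₁).sub (hlip ν₂)))
        continuous_const
    · exact le_iSup (fun n => ENNReal.ofReal
        (∫ y, (TopologicalSpace.denseSeq lipBall n : C(Disc, ℝ)) y ∂ν₁ -
          ∫ y, (TopologicalSpace.denseSeq lipBall n : C(Disc, ℝ)) y ∂ν₂)) n
  refine iSup_le fun g => iSup_le fun hg => iSup_le fun hg1 => ?_
  rcases le_total 0 (∫ y, g y ∂ν₁ - ∫ y, g y ∂ν₂) with h0 | h0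
  · rw [abs_of_nonneg h0]
    exact key ⟨⟨g, hg.continuous⟩, hg, hg1⟩
  · rw [abs_of_nonpos h0, neg_sub]
    have := key ⟨⟨fun y => -g y, hg.continuous.neg⟩, hg.neg, fun y => by simpa using hg1 y⟩
    simp only [ContinuousMap.coe_mk, integral_neg] at this
    rwa [neg_sub_neg] at this

/-- The difference of the integrals of `h` over the leaf at `γ` for `μ⁺` and `μ⁻`. -/
def leafDiff (μ : SignedMeasure SolidTorus) (h : SolidTorus → ℝ) (γ : UnitAddCircle) : ℝ :=
  ∫ y, h (γ, y) ∂(leaf (pos μ) γ) - ∫ y, h (γ, y) ∂(leaf (neg μ) γ)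

theorem measurable_leafDiff (μ : SignedMeasure SolidTorus) {h : SolidTorus → ℝ}
    (hh : Measurable h) : Measurable (leafDiff μ h) :=
  (measurable_integral_leaf _ hh).sub (measurable_integral_leaf _ hh)

/-- Test functions may jump between leaves, so on each leaf the better of two candidates can be
selected; the selection set is measurable. Starting from 0 keeps the value nonnegative. -/
theorem exists_isTest_forall_leafDiff_le (μ : SignedMeasure SolidTorus) (g : ℕ → SolidTorus → ℝ)
    (hg : ∀ n, IsTest 1 (g n)) (n : ℕ) :
    ∃ h, IsTest 1 h ∧ (∀ γ, 0 ≤ leafDiff μ h γ) ∧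
      ∀ i < n, ∀ γ, leafDiff μ (g i) γ ≤ leafDiff μ h γ := by
  induction n with
  | zero =>
    exact ⟨fun _ => 0, ⟨measurable_const, by simp, by simp⟩, by simp [leafDiff], by simp⟩
  | succ n ih =>
    obtain ⟨h, hh, h0, hi⟩ := ih
    set S : Set UnitAddCircle := {γ | leafDiff μ h γ < leafDiff μ (g n) γ}
    have hS : MeasurableSet S := measurableSet_lt (measurable_leafDiff μ hh.measurable)
      (measurable_leafDiff μ (hg n).measurable)
    classical
    let k : SolidTorus → ℝ := fun p => if p.1 ∈ S then g n p else h p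
    have hk : ∀ γ, leafDiff μ k γ = if γ ∈ S then leafDiff μ (g n) γ else leafDiff μ h γ := by
      intro γ
      by_cases hγ : γ ∈ S <;> simp [leafDiff, k, hγ]
    have hkh : ∀ γ, leafDiff μ h γ ≤ leafDiff μ k γ := by
      intro γ
      rw [hk]
      split_ifs with hγ
      · exact le_of_lt hγ
      · exact le_rfl
    refine ⟨k, ⟨?_, fun p => ?_, fun x y₁ y₂ => ?_⟩, fun γ => (h0 γ).trans (hkh γ), ?_⟩
    · exact Measurable.ite (measurable_fst hS) (hg n).measurable hh.measurable
    · simp only [k]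
      split_ifs
      exacts [(hg n).abs_le p, hh.abs_le p]
    · simp only [k]
      split_ifs
      exacts [(hg n).lip x y₁ y₂, hh.lip x y₁ y₂]
    · intro i hin γ
      rcases Nat.lt_succ_iff_lt_or_eq.1 hin with hlt | rfl
      · exact (hi i hlt γ).trans (hkh γ)
      · rw [hk]
        split_ifs with hγ
        · exact le_rfl
        · exact not_lt.1 hγ

theorem integral_leafDiff {μ : SignedMeasure SolidTorus} (hμ : IsAB μ) {h : SolidTorus → ℝ}
    (hh : IsTest 1 h) :
    Integrable (leafDiff μ h) ∧ ∫ γ, leafDiff μ h γ = signedIntegral μ h := by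
  obtain ⟨i1, e1⟩ := integral_leaf (pos μ) hμ.1 hh.measurable hh.abs_le
  obtain ⟨i2, e2⟩ := integral_leaf (neg μ) hμ.2 hh.measurable hh.abs_le
  refine ⟨i1.sub i2, ?_⟩
  unfold leafDiff
  rw [integral_sub i1 i2, e1, e2, signedIntegral]

/-- The integral of a supremum is reached by monotone convergence along finite maxima of a dense
family, and each finite maximum is dominated leafwise by a single test function. -/
theorem weakNorm_le {μ : SignedMeasure SolidTorus} (hμ : IsAB μ) {C : ℝ}
    (hC : ∀ h, IsTest 1 h → signedIntegral μ h ≤ C) : weakNorm μ ≤ ENNReal.ofReal C := by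
  set g : ℕ → SolidTorus → ℝ :=
    fun n p => (TopologicalSpace.denseSeq lipBall n : C(Disc, ℝ)) p.2 with hgdef
  have hg : ∀ n, IsTest 1 (g n) := by
    intro n
    have h := (TopologicalSpace.denseSeq lipBall n).2
    refine ⟨(h.1.continuous.measurable).comp measurable_snd, fun p => h.2 _, fun x y₁ y₂ => ?_⟩
    simpa [Real.dist_eq] using h.1.dist_le_mul y₁ y₂
  set f : ℕ → UnitAddCircle → ℝ≥0∞ :=
    fun n γ => ⨆ i : ℕ, ⨆ _ : i < n, ENNReal.ofReal (leafDiff μ (g i) γ) with hf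
  have hfm : ∀ n, Measurable (f n) := fun n => Measurable.iSup fun i => Measurable.iSup fun _ =>
    (measurable_leafDiff μ (hg i).measurable).ennreal_ofReal
  have hmono : Monotone f := fun m n hmn γ => iSup_mono fun i =>
    iSup_le fun him => le_iSup_of_le (him.trans_le hmn) le_rfl
  calc weakNorm μ ≤ ∫⁻ γ, ⨆ n, f n γ := by
        refine lintegral_mono_ae ?_
        filter_upwards [ae_isFiniteMeasure_leaf (pos μ), ae_isFiniteMeasure_leaf (neg μ)]
          with γ h1 h2
        refine (wasserstein_le_iSup_denseSeq _ _).trans (iSup_le fun n => ?_)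
        exact le_iSup_of_le (n + 1) (le_iSup_of_le n (le_iSup_of_le n.lt_succ_self le_rfl))
    _ = ⨆ n, ∫⁻ γ, f n γ := lintegral_iSup hfm hmono
    _ ≤ ENNReal.ofReal C := by
        refine iSup_le fun n => ?_
        obtain ⟨h, hh, h0, hi⟩ := exists_isTest_forall_leafDiff_le μ g hg n
        obtain ⟨hint, hval⟩ := integral_leafDiff hμ hh
        calc ∫⁻ γ, f n γ ≤ ∫⁻ γ, ENNReal.ofReal (leafDiff μ h γ) :=
              lintegral_mono fun γ => iSup_le fun i => iSup_le fun hin =>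
                ENNReal.ofReal_le_ofReal (hi i hin γ)
          _ = ENNReal.ofReal (signedIntegral μ h) := by
              rw [← hval, ofReal_integral_eq_lintegral_ofReal hint
                (Filter.Eventually.of_forall h0)]
          _ ≤ ENNReal.ofReal C := ENNReal.ofReal_le_ofReal (hC h hh)

theorem abs_signedIntegral_le_mass (μ : SignedMeasure SolidTorus) {h : SolidTorus → ℝ}
    (hh : IsTest 1 h) : |signedIntegral μ h| ≤ (pos μ).real univ + (neg μ).real univ := by
  have key : ∀ (ν : Measure SolidTorus) [IsFiniteMeasure ν], |∫ p, h p ∂ν| ≤ ν.real univ := by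
    intro ν _
    simpa using norm_integral_le_of_norm_le_const (μ := ν) (f := h) (C := 1)
      (Filter.Eventually.of_forall hh.abs_le)
  exact (abs_sub _ _).trans (add_le_add (key _) (key _))

/-- Total mass bounds the weak norm, so finiteness is automatic on `𝒜ℬ`. -/
theorem IsAB.mem_spaceL1 {μ : SignedMeasure SolidTorus} (hμ : IsAB μ) : μ ∈ spaceL1 :=
  ⟨hμ, (weakNorm_le hμ fun _ hh =>
    (le_abs_self _).trans (abs_signedIntegral_le_mass μ hh)).trans_lt ENNReal.ofReal_lt_top⟩

theorem integrable_marginalDensity (μ : SignedMeasure SolidTorus) :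
    Integrable (marginalDensity μ) :=
  Measure.integrable_toReal_rnDeriv.sub Measure.integrable_toReal_rnDeriv

theorem signedIntegral_comp_fst {μ : SignedMeasure SolidTorus} (hμ : IsAB μ)
    {v : UnitAddCircle → ℝ} (hv : Measurable v) {C : ℝ} (hC : ∀ x, |v x| ≤ C) :
    signedIntegral μ (fun p => v p.1) = ∫ γ, v γ * marginalDensity μ γ := by
  have key : ∀ (ν : Measure SolidTorus) [IsFiniteMeasure ν], ν.fst ≪ volume →
      ∫ p, v p.1 ∂ν = ∫ γ, v γ * (ν.fst.rnDeriv volume γ).toReal := by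
    intro ν _ hν
    rw [← integral_map (φ := Prod.fst) measurable_fst.aemeasurable hv.aestronglyMeasurable]
    change ∫ γ, v γ ∂ν.fst = _
    rw [← integral_rnDeriv_smul hν]
    simp only [smul_eq_mul, mul_comm]
  rw [signedIntegral, key _ hμ.1, key _ hμ.2, ← integral_sub
    (integrable_bdd_mul hv hC Measure.integrable_toReal_rnDeriv)
    (integrable_bdd_mul hv hC Measure.integrable_toReal_rnDeriv)]
  simp only [marginalDensity, mul_sub]

theorem signedIntegral_one (μ : SignedMeasure SolidTorus) :
    signedIntegral μ (fun _ => 1) = μ univ := by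
  rw [isDiff_pos_neg μ univ MeasurableSet.univ]
  simp [signedIntegral]


/-! ### The skew product and exponential convergence -/

theorem IsC2FiberMap.continuous {G : SolidTorus → Disc} (h : IsC2FiberMap G) : Continuous G := by
  obtain ⟨g, hg, hG⟩ := h
  -- Openness matters: a product of quotient maps need not be a quotient map.
  have hq : IsOpenQuotientMap (Prod.map ((↑) : ℝ → UnitAddCircle) (id : Disc → Disc)) :=
    QuotientAddGroup.isOpenQuotientMap_mk.prodMap IsOpenQuotientMap.id
  rw [hq.isQuotientMap.continuous_iff, continuous_induced_rng]
  have h1 : (Subtype.val ∘ G ∘ Prod.map ((↑) : ℝ → UnitAddCircle) (id : Disc → Disc))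
      = fun p : ℝ × Disc => g (p.1, p.2) := funext fun p => (hG p.1 p.2).symm
  rw [h1]
  exact hg.continuousOn.comp_continuous (by fun_prop) fun p => ⟨mem_univ _, p.2.2⟩

/-- A continuous skew product, contracting along the leaves, whose base map has an invariant cone
of densities. -/
structure SolenoidData (T : UnitAddCircle → UnitAddCircle) (G : SolidTorus → Disc)
    (a θ α : ℝ) : Prop extends ConeData T a θ where
  continuous : Continuous (skewProduct T G)
  α_pos : 0 < α
  α_lt : α < 1
  contracting : ∀ x y₁ y₂, dist (G (x, y₁)) (G (x, y₂)) ≤ α * dist y₁ y₂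

theorem IsSolenoidal.exists_solenoidData {T : UnitAddCircle → UnitAddCircle}
    {G : SolidTorus → Disc} (h : IsSolenoidal T G) : ∃ a θ α, SolenoidData T G a θ α := by
  obtain ⟨L⟩ := h.expanding.nonempty_liftData
  obtain ⟨a, θ, H⟩ := L.exists_coneData
  obtain ⟨α, h0, h1, hα⟩ := h.contracting
  exact ⟨a, θ, α, H, (L.continuous.comp continuous_fst).prodMk h.smooth.continuous, h0, h1, hα⟩

/-- The density of `T^n_* m` lies in the cone and has mass 1, hence is at most `exp a`, uniformly in
`n`. -/
theorem ConeData.volume_preimage_iterate_le {T : UnitAddCircle → UnitAddCircle} {a θ : ℝ}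
    (H : ConeData T a θ) (n : ℕ) {E : Set UnitAddCircle} (hE : MeasurableSet E) :
    volume (T^[n] ⁻¹' E) ≤ ENNReal.ofReal (Real.exp a) * volume E := by
  obtain ⟨g, hg, hu⟩ := H.exists_density n _ (logLip_const H.a_pos.le zero_le_one)
  have hind : Measurable (E.indicator (1 : UnitAddCircle → ℝ)) := measurable_one.indicator hE
  have hb : ∀ x, |E.indicator (1 : UnitAddCircle → ℝ) x| ≤ 1 := fun x => by
    by_cases hx : x ∈ E <;> simp [hx]
  have h1 := hu _ hind ⟨1, hb⟩
  have hg1 : ∫ x, g x = 1 := by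
    have := hu (fun _ => 1) measurable_const ⟨1, by simp⟩
    simpa using this.symm
  have h2 : ∫ x, E.indicator (1 : UnitAddCircle → ℝ) (T^[n] x) * 1
      = volume.real (T^[n] ⁻¹' E) := by
    rw [← integral_indicator_one (H.measurable.iterate n hE)]
    simp only [mul_one]
    rfl
  have h3 : ∫ x, E.indicator (1 : UnitAddCircle → ℝ) x * g x ≤ Real.exp a * volume.real E := by
    rw [← integral_indicator_one hE, ← integral_const_mul]
    refine integral_mono (integrable_bdd_mul hind hb hg.continuous.integrable_unitAddCircle)
      (((integrable_const 1).indicator hE).const_mul _) fun x => ?_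
    have h4 := hg.le_integral H.a_pos.le x
    rw [hg1, mul_one] at h4
    rw [mul_comm]
    exact mul_le_mul_of_nonneg_right h4 (indicator_nonneg (by simp) x)
  rw [← h1, h2] at h3
  rw [← ofReal_measureReal, ← ofReal_measureReal (s := E), ← ENNReal.ofReal_mul (Real.exp_pos _).le]
  exact ENNReal.ofReal_le_ofReal h3

namespace SolenoidData

variable {T : UnitAddCircle → UnitAddCircle} {G : SolidTorus → Disc} {a θ α : ℝ}

theorem fst_iterate (n : ℕ) (p : SolidTorus) : ((skewProduct T G)^[n] p).1 = T^[n] p.1 := by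
  induction n generalizing p with
  | zero => rfl
  | succ n ih => rw [Function.iterate_succ_apply, ih]; rfl

theorem dist_snd_iterate_le (S : SolenoidData T G a θ α) (n : ℕ) (x : UnitAddCircle)
    (y₁ y₂ : Disc) :
    dist ((skewProduct T G)^[n] (x, y₁)).2 ((skewProduct T G)^[n] (x, y₂)).2 ≤
      α ^ n * dist y₁ y₂ := by
  induction n generalizing x y₁ y₂ with
  | zero => simp
  | succ n ih =>
    rw [Function.iterate_succ_apply, Function.iterate_succ_apply]
    refine (ih (T x) (G (x, y₁)) (G (x, y₂))).trans ?_
    rw [pow_succ, mul_assoc]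
    exact mul_le_mul_of_nonneg_left (S.contracting _ _ _) (pow_nonneg S.α_pos.le n)

theorem abs_comp_iterate_sub_le (S : SolenoidData T G a θ α) {c : ℝ} {h : SolidTorus → ℝ}
    (hh : IsTest c h) (n : ℕ) (x : UnitAddCircle) (y₁ y₂ : Disc) :
    |h ((skewProduct T G)^[n] (x, y₁)) - h ((skewProduct T G)^[n] (x, y₂))| ≤
      c * (α ^ n * dist y₁ y₂) := by
  have hc : 0 ≤ c := (abs_nonneg _).trans (hh.abs_le (x, y₁))
  have h1 : ∀ y, (skewProduct T G)^[n] (x, y)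
      = (T^[n] x, ((skewProduct T G)^[n] (x, y)).2) := fun y =>
    Prod.ext (fst_iterate n (x, y)) rfl
  rw [h1 y₁, h1 y₂]
  exact (hh.lip _ _ _).trans (mul_le_mul_of_nonneg_left (S.dist_snd_iterate_le n x y₁ y₂) hc)

theorem isAB_transfer (S : SolenoidData T G a θ α) {μ : SignedMeasure SolidTorus} (hμ : IsAB μ) :
    IsAB (transfer (skewProduct T G) μ) := by
  have key : ∀ ν : Measure SolidTorus, ν.fst ≪ volume →
      (ν.map (skewProduct T G)).fst ≪ volume := by
    intro ν hν
    refine Measure.AbsolutelyContinuous.mk fun E hE h0 => ?_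
    rw [Measure.fst_apply hE, Measure.map_apply S.continuous.measurable (measurable_fst hE)]
    have h1 : volume (T ⁻¹' E) = 0 := by
      have := S.volume_preimage_iterate_le 1 hE
      rw [h0, mul_zero] at this
      simpa using this
    have h2 := hν h1
    rwa [Measure.fst_apply (S.measurable hE)] at h2
  exact (isDiff_transfer S.continuous.measurable (isDiff_pos_neg μ)).isAB (key _ hμ.1) (key _ hμ.2)

theorem isAB_iterate_transfer (S : SolenoidData T G a θ α) {μ : SignedMeasure SolidTorus}
    (hμ : IsAB μ) (n : ℕ) : IsAB ((transfer (skewProduct T G))^[n] μ) := by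
  induction n with
  | zero => exact hμ
  | succ n ih =>
    rw [Function.iterate_succ_apply']
    exact S.isAB_transfer ih

theorem signedIntegral_add {μ : SignedMeasure SolidTorus} {f g : SolidTorus → ℝ} {C D : ℝ}
    (hf : Measurable f) (hC : ∀ p, |f p| ≤ C) (hg : Measurable g) (hD : ∀ p, |g p| ≤ D) :
    signedIntegral μ (fun p => f p + g p) = signedIntegral μ f + signedIntegral μ g := by
  unfold signedIntegral
  rw [integral_add (integrable_of_bounded hf hC) (integrable_of_bounded hg hD),
    integral_add (integrable_of_bounded hf hC) (integrable_of_bounded hg hD)]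
  ring

/-- Along `k + l` iterates, a test function is, up to an error contracted by `α ^ k`, a function
of the base point after `l` iterates. -/
theorem exists_abs_signedIntegral_iterate_le (S : SolenoidData T G a θ α)
    {μ : SignedMeasure SolidTorus} (hμ : μ ∈ spaceL1) {h : SolidTorus → ℝ} (hh : IsTest 1 h)
    (k l : ℕ) : ∃ v : UnitAddCircle → ℝ, Measurable v ∧ (∀ x, |v x| ≤ 1) ∧
      |signedIntegral ((transfer (skewProduct T G))^[k + l] μ) h| ≤
        α ^ k * (weakNorm μ).toReal + |∫ γ, v (T^[l] γ) * marginalDensity μ γ| := by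
  have hα := S.α_pos
  have hFm := S.continuous.measurable
  set F := skewProduct T G with hF
  -- The centre is within distance 1 of every point, so the remainder `r` is bounded by `α ^ k`
  -- itself.
  let o : Disc := ⟨0, by simp⟩
  have ho : ∀ y : Disc, dist y o ≤ 1 := fun y => y.2
  set v : UnitAddCircle → ℝ := fun x => h (F^[k] (x, o)) with hv
  have hvm : Measurable v :=
    hh.measurable.comp ((hFm.iterate k).comp (measurable_id.prodMk measurable_const))
  have hv1 : ∀ x, |v x| ≤ 1 := fun x => hh.abs_le _
  set r : SolidTorus → ℝ := fun p => h (F^[k] p) - v p.1 with hr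
  have hrm : Measurable r := (hh.measurable.comp (hFm.iterate k)).sub (hvm.comp measurable_fst)
  have hrt : IsTest (α ^ k) r := by
    refine ⟨hrm, fun p => ?_, fun x y₁ y₂ => ?_⟩
    · have h1 := S.abs_comp_iterate_sub_le hh k p.1 p.2 o
      rw [one_mul] at h1
      exact h1.trans (mul_le_of_le_one_right (by positivity) (ho _))
    · have h1 := S.abs_comp_iterate_sub_le hh k x y₁ y₂
      rw [one_mul] at h1
      simpa only [hr, sub_sub_sub_cancel_right] using h1
  -- Composition with `F^l` does not increase Lipschitz constants along leaves.
  have hrl : IsTest (α ^ k) (r ∘ F^[l]) := by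
    refine ⟨hrm.comp (hFm.iterate l), fun p => hrt.abs_le _, fun x y₁ y₂ => ?_⟩
    refine (S.abs_comp_iterate_sub_le hrt l x y₁ y₂).trans ?_
    refine mul_le_mul_of_nonneg_left ?_ (by positivity)
    exact mul_le_of_le_one_left dist_nonneg (pow_le_one₀ hα.le S.α_lt.le)
  have hvl : Measurable fun x => v (T^[l] x) := hvm.comp (S.measurable.iterate l)
  refine ⟨v, hvm, hv1, ?_⟩
  have h1 : h ∘ F^[k + l] = fun p => (r ∘ F^[l]) p + v (T^[l] p.1) := by
    funext p
    rw [Function.iterate_add]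
    simp only [Function.comp_apply, hr, hF, fst_iterate]
    ring
  rw [signedIntegral_iterate_transfer hFm _ _ hh.measurable hh.abs_le, h1,
    signedIntegral_add (g := fun p => v (T^[l] p.1)) hrl.measurable hrl.abs_le
      (hvl.comp measurable_fst) (fun p => hv1 _),
    signedIntegral_comp_fst hμ.1 hvl (fun x => hv1 _)]
  exact (abs_add_le _ _).trans (add_le_add_left (abs_signedIntegral_le hμ (by positivity) hrl) _)

theorem integral_marginalDensity {μ : SignedMeasure SolidTorus} (hμ : IsAB μ) :
    ∫ γ, marginalDensity μ γ = μ univ := by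
  rw [← signedIntegral_one]
  simpa using (signedIntegral_comp_fst hμ (v := fun _ => 1) measurable_const (C := 1)
    (by simp)).symm

theorem weakNorm_iterate_le (S : SolenoidData T G a θ α)
    {μ : SignedMeasure SolidTorus} (hμ : μ ∈ zeroAverage) {f f' : UnitAddCircle → ℝ}
    (hf : HasL1Deriv f f') (hfφ : f =ᵐ[volume] marginalDensity μ) (k l : ℕ) :
    weakNorm ((transfer (skewProduct T G))^[k + l] μ) ≤ ENNReal.ofReal
      (α ^ k * (weakNorm μ).toReal + (2 * (1 + 1 / a) + 4) * √θ ^ l * ∫ x, |f' x|) := by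
  refine weakNorm_le (S.isAB_iterate_transfer hμ.1.1 _) fun h hh => ?_
  obtain ⟨v, hv, hv1, hle⟩ := S.exists_abs_signedIntegral_iterate_le hμ.1 hh k l
  refine (le_abs_self _).trans (hle.trans (add_le_add_right ?_ _))
  have h0 : ∫ x, f x = 0 := by
    rw [integral_congr_ae hfφ, integral_marginalDensity hμ.1.1, hμ.2]
  have h1 : ∫ γ, v (T^[l] γ) * marginalDensity μ γ = ∫ γ, v (T^[l] γ) * f γ := by
    refine integral_congr_ae ?_
    filter_upwards [hfφ] with γ hγ
    rw [hγ]
  rw [h1]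
  exact S.decay_of_hasL1Deriv hf h0 hv hv1 l

theorem exponential_convergence (S : SolenoidData T G a θ α) :
    ∃ D β : ℝ, 0 < D ∧ 0 < β ∧ β < 1 ∧ ∀ μ ∈ zeroAverage, ∀ n : ℕ,
      weakNorm ((transfer (skewProduct T G))^[n] μ) ≤
        ENNReal.ofReal (D * β ^ n) * (weakNorm μ + sobolevNorm (marginalDensity μ)) := by
  have ha := S.a_pos
  have hα := S.α_pos
  have hθ := S.θ_pos
  -- Half of the time goes to the fibre rate `α` and half to the base rate `√θ`, so each rate loses
  -- a square root.
  set β := max (√α) (√√θ) with hβ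
  have hβ0 : 0 < β := lt_max_of_lt_left (Real.sqrt_pos.2 hα)
  have hβ1 : β < 1 := max_lt ((Real.sqrt_lt' one_pos).2 (by simpa using S.α_lt))
    ((Real.sqrt_lt' one_pos).2 ((Real.sqrt_lt' (by norm_num)).2 (by simpa using S.θ_lt)))
  set C := 2 * (1 + 1 / a) + 4 with hC
  have hC1 : 1 ≤ C := by
    have : 0 < 1 / a := by positivity
    linarith
  -- The factor `β⁻¹` absorbs the rounding of `n / 2` for odd `n`.
  have hpow : ∀ {ρ : ℝ}, 0 ≤ ρ → √ρ ≤ β → ∀ n m : ℕ, n ≤ 2 * m + 1 → ρ ^ m ≤ β⁻¹ * β ^ n := by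
    intro ρ hρ hρβ n m hnm
    rw [le_inv_mul_iff₀ hβ0]
    calc β * ρ ^ m = β * √ρ ^ (2 * m) := by rw [pow_mul, Real.sq_sqrt hρ]
      _ ≤ β * β ^ (2 * m) := by gcongr
      _ = β ^ (2 * m + 1) := by ring
      _ ≤ β ^ n := pow_le_pow_of_le_one hβ0.le hβ1.le hnm
  refine ⟨C * β⁻¹, β, by positivity, hβ0, hβ1, fun μ hμ n => ?_⟩
  set K := C * β⁻¹ * β ^ n with hK
  have hK0 : 0 < K := by positivity
  have key : ∀ f f', HasL1Deriv f f' → f =ᵐ[volume] marginalDensity μ →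
      weakNorm ((transfer (skewProduct T G))^[n] μ) ≤
        ENNReal.ofReal K * (weakNorm μ + (eLpNorm f 1 volume + eLpNorm f' 1 volume)) := by
    intro f f' hf hfφ
    have h1 := S.weakNorm_iterate_le hμ hf hfφ (n / 2) (n - n / 2)
    rw [Nat.add_sub_cancel' (Nat.div_le_self n 2)] at h1
    refine h1.trans ?_
    have h2 : eLpNorm f' 1 volume = ENNReal.ofReal (∫ x, |f' x|) := by
      rw [eLpNorm_one_eq_lintegral_enorm, ← ofReal_integral_norm_eq_lintegral_enorm hf.1]
      rfl
    have h3 : 0 ≤ ∫ x, |f' x| := integral_nonneg fun x => abs_nonneg _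
    have h4 : α ^ (n / 2) ≤ K := by
      refine (hpow hα.le (le_max_left _ _) n (n / 2) (by omega)).trans ?_
      rw [hK, mul_assoc]
      exact le_mul_of_one_le_left (by positivity) hC1
    have h5 : C * √θ ^ (n - n / 2) ≤ K := by
      rw [hK, mul_assoc]
      exact mul_le_mul_of_nonneg_left (hpow (Real.sqrt_nonneg _) (le_max_right _ _) n (n - n / 2)
        (by omega)) (by linarith)
    calc ENNReal.ofReal (α ^ (n / 2) * (weakNorm μ).toReal + C * √θ ^ (n - n / 2) * ∫ x, |f' x|)
        ≤ ENNReal.ofReal (K * ((weakNorm μ).toReal + ∫ x, |f' x|)) := by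
          refine ENNReal.ofReal_le_ofReal ?_
          rw [mul_add]
          gcongr
      _ = ENNReal.ofReal K * (weakNorm μ + eLpNorm f' 1 volume) := by
          rw [ENNReal.ofReal_mul hK0.le, ENNReal.ofReal_add ENNReal.toReal_nonneg h3,
            ENNReal.ofReal_toReal hμ.1.2.ne, h2]
      _ ≤ _ := by gcongr; exact le_add_self
  have hKne : ENNReal.ofReal K ≠ 0 := (ENNReal.ofReal_pos.2 hK0).ne'
  -- Dividing and subtracting isolates the Sobolev norm, so that the bound passes to the infimum
  -- defining it, including the empty case where it is `∞`.
  have hsob : weakNorm ((transfer (skewProduct T G))^[n] μ) / ENNReal.ofReal K - weakNorm μ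
      ≤ sobolevNorm (marginalDensity μ) := by
    refine le_iInf fun f => le_iInf fun f' => le_iInf fun hf => le_iInf fun hfφ => ?_
    rw [tsub_le_iff_left]
    exact (ENNReal.div_le_iff' hKne ENNReal.ofReal_ne_top).2 (key f f' hf hfφ)
  rw [tsub_le_iff_left] at hsob
  exact (ENNReal.div_le_iff' hKne ENNReal.ofReal_ne_top).1 hsob

theorem tendsto_signedIntegral_iterate (S : SolenoidData T G a θ α)
    {μ : SignedMeasure SolidTorus} (hμ : IsAB μ) (h0 : μ univ = 0) {h : SolidTorus → ℝ}
    (hh : IsTest 1 h) : Filter.Tendsto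
      (fun n => signedIntegral ((transfer (skewProduct T G))^[n] μ) h) Filter.atTop (nhds 0) := by
  rw [Metric.tendsto_atTop]
  intro ε hε
  have hα := S.α_pos
  obtain ⟨k, hk⟩ : ∃ k : ℕ, α ^ k * (weakNorm μ).toReal < ε / 2 := by
    have h1 : Filter.Tendsto (fun k => α ^ k * (weakNorm μ).toReal) Filter.atTop (nhds 0) := by
      simpa using (tendsto_pow_atTop_nhds_zero_of_lt_one hα.le S.α_lt).mul_const
        (weakNorm μ).toReal
    exact (h1.eventually (gt_mem_nhds (by positivity : 0 < ε / 2))).exists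
  obtain ⟨N, hN⟩ := S.mixes (integrable_marginalDensity μ) (ε / 4) (by positivity)
  refine ⟨k + N, fun n hn => ?_⟩
  obtain ⟨v, hv, hv1, hle⟩ := S.exists_abs_signedIntegral_iterate_le hμ.mem_spaceL1 hh k (n - k)
  have h1 := hN (n - k) (by omega) v hv hv1
  rw [integral_marginalDensity hμ, h0] at h1
  simp only [sub_zero] at h1
  rw [Nat.add_sub_cancel' (by omega)] at hle
  rw [Real.dist_eq, sub_zero]
  linarith

end SolenoidData

/-! ### Uniqueness and existence of the invariant measure -/

theorem isTest_of_lipschitz {c : ℝ} {h : SolidTorus → ℝ} (hb : ∀ p, |h p| ≤ c)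
    (hl : ∀ p q, |h p - h q| ≤ c * dist p q) : IsTest c h := by
  have hc : 0 ≤ c := (abs_nonneg _).trans (hb ((0 : UnitAddCircle), Classical.arbitrary Disc))
  refine ⟨?_, hb, fun x y₁ y₂ => by simpa [Prod.dist_eq] using hl (x, y₁) (x, y₂)⟩
  refine (LipschitzWith.of_dist_le_mul (K := c.toNNReal) fun p q => ?_).continuous.measurable
  rw [Real.dist_eq, Real.coe_toNNReal _ hc]
  exact hl p q

/-- Finite measures on the solid torus are determined by the integrals of continuous test
functions. -/
theorem ext_of_forall_isTest {ν₁ ν₂ : Measure SolidTorus} [IsFiniteMeasure ν₁] [IsFiniteMeasure ν₂]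
    (h : ∀ f : SolidTorus → ℝ, Continuous f → IsTest 1 f → ∫ p, f p ∂ν₁ = ∫ p, f p ∂ν₂) :
    ν₁ = ν₂ := by
  have key : ∀ A : Set SolidTorus, IsClosed A → ν₁ A = ν₂ A := by
    intro A hA
    have hpos : ∀ n : ℕ, 0 < 1 / ((n : ℝ) + 1) := fun n => Nat.one_div_pos_of_nat
    have t1 := tendsto_integral_thickenedIndicator_of_isClosed ν₁ hA hpos
      tendsto_one_div_add_atTop_nhds_zero_nat
    have t2 := tendsto_integral_thickenedIndicator_of_isClosed ν₂ hA hpos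
      tendsto_one_div_add_atTop_nhds_zero_nat
    refine (measureReal_eq_measureReal_iff).1 (tendsto_nhds_unique t1 ?_)
    refine t2.congr fun n => ?_
    set δ := 1 / ((n : ℝ) + 1)
    set ψ : SolidTorus → ℝ := fun p => thickenedIndicator (hpos n) A p with hψ
    have hδ : 0 < δ := hpos n
    have hδ1 : δ ≤ 1 := by
      rw [div_le_one (by positivity)]
      linarith [(Nat.cast_nonneg n : (0 : ℝ) ≤ n)]
    have hψL : ∀ p q, |ψ p - ψ q| ≤ δ⁻¹ * dist p q := by
      intro p q
      have h := (lipschitzWith_thickenedIndicator hδ A).dist_le_mul p q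
      rw [NNReal.dist_eq, NNReal.coe_inv, Real.coe_toNNReal _ hδ.le] at h
      exact h
    have hψb : ∀ p, |ψ p| ≤ 1 := fun p => by
      rw [abs_of_nonneg (NNReal.coe_nonneg _)]
      exact_mod_cast thickenedIndicator_le_one (hpos n) A p
    have hψc : Continuous ψ :=
      NNReal.continuous_coe.comp (thickenedIndicator hδ A).continuous
    -- The factor `δ ≤ 1` normalises a `δ⁻¹`-Lipschitz function and cancels from the equality of
    -- integrals.
    have ht : IsTest 1 fun p => δ * ψ p := by
      refine isTest_of_lipschitz (fun p => ?_) fun p q => ?_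
      · rw [abs_mul, abs_of_pos hδ]
        exact mul_le_one₀ hδ1 (abs_nonneg _) (hψb p)
      · rw [← mul_sub, abs_mul, abs_of_pos hδ, one_mul, ← le_inv_mul_iff₀ hδ]
        exact hψL p q
    have h1 := h _ (hψc.const_mul δ) ht
    rw [integral_const_mul, integral_const_mul] at h1
    exact (mul_left_cancel₀ hδ.ne' h1).symm
  refine ext_of_generate_finite {s | IsClosed s} ?_ isPiSystem_isClosed (fun s hs => key s hs)
    (key univ isClosed_univ)
  rw [← borel_eq_generateFrom_isClosed]
  exact BorelSpace.measurable_eq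


namespace SolenoidData

variable {T : UnitAddCircle → UnitAddCircle} {G : SolidTorus → Disc} {a θ α : ℝ}

/-- The difference `ν - ν(X) ρ` is invariant with zero average: its integrals against test functions
are constant along iterates and tend to 0, so they vanish. -/
theorem eq_smul_of_invariant (S : SolenoidData T G a θ α) {ρ : Measure SolidTorus}
    [IsProbabilityMeasure ρ] (hρ : ρ.fst ≪ volume) (hinv : ρ.map (skewProduct T G) = ρ)
    {ν : SignedMeasure SolidTorus} (hν : ν ∈ spaceL1) (hνinv : transfer (skewProduct T G) ν = ν) :
    ν = ν univ • ρ.toSignedMeasure := by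
  have hFm := S.continuous.measurable
  set c := ν univ with hc
  set η : SignedMeasure SolidTorus := ν - c • ρ.toSignedMeasure with hη
  have hηE : ∀ E, MeasurableSet E → η E = ν E - c * ρ.real E := by
    intro E hE
    rw [hη, sub_apply, smul_apply, Measure.toSignedMeasure_apply_measurable hE, smul_eq_mul]
  -- The scalar `c` may be negative; its positive and negative parts go to opposite sides.
  have hdiff : IsDiff η (pos ν + (-c).toNNReal • ρ) (neg ν + c.toNNReal • ρ) := by
    intro E hE
    rw [hηE E hE, isDiff_pos_neg ν E hE, measureReal_add_apply, measureReal_add_apply,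
      measureReal_nnreal_smul_apply, measureReal_nnreal_smul_apply, Real.coe_toNNReal',
      Real.coe_toNNReal']
    have : c = max c 0 - max (-c) 0 := (max_zero_sub_max_neg_zero_eq_self c).symm
    linear_combination (-(ρ.real E)) * this
  have hac : ∀ (m : Measure SolidTorus) (r : NNReal), m.fst ≪ volume →
      (m + r • ρ).fst ≪ volume := by
    intro m r hm
    refine Measure.AbsolutelyContinuous.mk fun E hE h0 => ?_
    have h1 := hm h0
    have h2 := hρ h0
    rw [Measure.fst_apply hE] at h1 h2 ⊢
    rw [Measure.add_apply, Measure.smul_apply, h1, h2]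
    simp
  have hAB : IsAB η := hdiff.isAB (hac _ _ hν.1.1) (hac _ _ hν.1.2)
  have hη0 : η univ = 0 := by
    rw [hηE univ MeasurableSet.univ, ← hc]
    simp
  have hηinv : transfer (skewProduct T G) η = η := by
    refine VectorMeasure.ext fun E hE => ?_
    have h1 : ν (skewProduct T G ⁻¹' E) = ν E := by
      conv_rhs => rw [← hνinv]
      rw [transfer, VectorMeasure.map_apply _ hFm hE]
    have h2 : ρ.real (skewProduct T G ⁻¹' E) = ρ.real E := by
      conv_rhs => rw [← hinv]
      rw [map_measureReal_apply hFm hE]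
    rw [transfer, VectorMeasure.map_apply _ hFm hE, hηE _ (hFm hE), hηE E hE, h1, h2]
  have hiter : ∀ n, (transfer (skewProduct T G))^[n] η = η := fun n =>
    Function.iterate_fixed hηinv n
  have hzero : ∀ h, IsTest 1 h → signedIntegral η h = 0 := by
    intro h hh
    have := S.tendsto_signedIntegral_iterate hAB hη0 hh
    simp only [hiter] at this
    exact tendsto_nhds_unique tendsto_const_nhds this
  have hpn : pos η = neg η := ext_of_forall_isTest fun f _ hf => sub_eq_zero.1 (hzero f hf)
  refine VectorMeasure.ext fun E hE => ?_
  have h1 := hηE E hE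
  rw [isDiff_pos_neg η E hE, hpn, sub_self] at h1
  rw [smul_apply, Measure.toSignedMeasure_apply_measurable hE, smul_eq_mul]
  linarith

/-- Weak limit of the images of `m × δ` under `F^n` along a subsequence. No averaging is needed:
consecutive images become close because the difference of the first two has zero average. -/
theorem exists_invariant (S : SolenoidData T G a θ α) :
    ∃ ρ : Measure SolidTorus, IsProbabilityMeasure ρ ∧ ρ.fst ≪ volume ∧
      ρ.map (skewProduct T G) = ρ := by
  have hFc := S.continuous
  have hFm := hFc.measurable
  set F := skewProduct T G with hF
  let ρ₀ : Measure SolidTorus := (volume : Measure UnitAddCircle).prod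
    (Measure.dirac (Classical.arbitrary Disc))
  have hρ₀ : IsProbabilityMeasure ρ₀ := by infer_instance
  have hfst : ρ₀.fst = volume := by simp [ρ₀]
  have hprob : ∀ n, IsProbabilityMeasure (ρ₀.map F^[n]) := fun n =>
    Measure.isProbabilityMeasure_map (hFm.iterate n).aemeasurable
  let r : ℕ → ProbabilityMeasure SolidTorus := fun n => ⟨ρ₀.map F^[n], hprob n⟩
  have hrE : ∀ n (U : Set UnitAddCircle), MeasurableSet U →
      (r n : Measure SolidTorus) (Prod.fst ⁻¹' U) ≤ ENNReal.ofReal (Real.exp a) * volume U := by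
    intro n U hU
    change ρ₀.map F^[n] (Prod.fst ⁻¹' U) ≤ _
    rw [Measure.map_apply (hFm.iterate n) (measurable_fst hU)]
    have h1 : F^[n] ⁻¹' (Prod.fst ⁻¹' U) = Prod.fst ⁻¹' (T^[n] ⁻¹' U) := by
      ext p
      simp only [mem_preimage, hF, fst_iterate]
    rw [h1, ← Measure.fst_apply (S.measurable.iterate n hU), hfst]
    exact S.volume_preimage_iterate_le n hU
  obtain ⟨ρ, φ, hφ, hlim⟩ := CompactSpace.tendsto_subseq r
  refine ⟨ρ, inferInstance, ?_, ?_⟩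
  -- Weak convergence transfers the density bound to open sets only; outer regularity of `m` extends
  -- absolute continuity to null sets.
  · have hopen : ∀ U : Set UnitAddCircle, IsOpen U →
        (ρ : Measure SolidTorus) (Prod.fst ⁻¹' U) ≤ ENNReal.ofReal (Real.exp a) * volume U := by
      intro U hU
      refine (ProbabilityMeasure.le_liminf_measure_open_of_tendsto hlim
        (hU.preimage continuous_fst)).trans ?_
      refine Filter.liminf_le_of_le (by isBoundedDefault) fun b hb => ?_
      obtain ⟨n, hn⟩ := hb.exists
      exact hn.trans (hrE (φ n) U hU.measurableSet)
    refine Measure.AbsolutelyContinuous.mk fun E hE h0 => ?_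
    rw [Measure.fst_apply hE]
    refine le_antisymm (ENNReal.le_of_forall_pos_le_add fun ε hε _ => ?_) zero_le
    have hea : ENNReal.ofReal (Real.exp a) ≠ 0 := (ENNReal.ofReal_pos.2 (Real.exp_pos a)).ne'
    have hε' : (0 : ℝ≥0∞) < ε / ENNReal.ofReal (Real.exp a) :=
      ENNReal.div_pos (by exact_mod_cast hε.ne') ENNReal.ofReal_ne_top
    obtain ⟨U, hEU, hU, hlt⟩ := E.exists_isOpen_lt_of_lt _ (h0.trans_lt hε')
    rw [zero_add]
    calc (ρ : Measure SolidTorus) (Prod.fst ⁻¹' E) ≤ (ρ : Measure SolidTorus) (Prod.fst ⁻¹' U) :=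
          measure_mono (preimage_mono hEU)
      _ ≤ ENNReal.ofReal (Real.exp a) * volume U := hopen U hU
      _ ≤ ENNReal.ofReal (Real.exp a) * (ε / ENNReal.ofReal (Real.exp a)) := by gcongr
      _ = ε := ENNReal.mul_div_cancel hea ENNReal.ofReal_ne_top
  -- The integral of `f` against the `n`-th iterate of `μ₀` equals `∫ f ∘ F - ∫ f` against `F^n_*
  -- ρ₀`, so its limit compares `F_* ρ` with `ρ`.
  · let μ₀ : SignedMeasure SolidTorus := (ρ₀.map F).toSignedMeasure - ρ₀.toSignedMeasure
    have hμ₀ : IsDiff μ₀ (ρ₀.map F) ρ₀ := fun E hE => Measure.toSignedMeasure_sub_apply hE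
    have hAB : IsAB μ₀ := by
      refine hμ₀.isAB (Measure.AbsolutelyContinuous.mk fun E hE h0 => ?_)
        (hfst ▸ Measure.AbsolutelyContinuous.rfl)
      have := hrE 1 E hE
      rw [h0, mul_zero] at this
      rw [Measure.fst_apply hE]
      exact le_antisymm this zero_le
    have hμ₀0 : μ₀ univ = 0 := by
      have := hprob 1
      rw [Function.iterate_one] at this
      rw [hμ₀ univ MeasurableSet.univ]
      simp
    refine ext_of_forall_isTest fun f hfc hf => ?_
    rw [integral_map hFm.aemeasurable hfc.aestronglyMeasurable]
    have hlim' := ProbabilityMeasure.tendsto_iff_forall_integral_tendsto.1 hlim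
    have t1 := hlim' (BoundedContinuousFunction.mkOfCompact ⟨fun p => f (F p), hfc.comp hFc⟩)
    have t2 := hlim' (BoundedContinuousFunction.mkOfCompact ⟨f, hfc⟩)
    have t3 := (S.tendsto_signedIntegral_iterate hAB hμ₀0 hf).comp hφ.tendsto_atTop
    simp only [BoundedContinuousFunction.mkOfCompact_apply, ContinuousMap.coe_mk] at t1 t2
    refine sub_eq_zero.1 (tendsto_nhds_unique (t1.sub t2) (t3.congr fun n => ?_))
    have hfn : Measurable (f ∘ F^[φ n]) := hf.measurable.comp (hFm.iterate _)
    simp only [Function.comp_apply]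
    rw [signedIntegral_iterate_transfer hFm _ _ hf.measurable hf.abs_le,
      hμ₀.signedIntegral_eq hfn (fun p => hf.abs_le _),
      integral_map hFm.aemeasurable hfn.aestronglyMeasurable]
    change _ = ∫ p, f (F p) ∂(ρ₀.map F^[φ n]) - ∫ p, f p ∂(ρ₀.map F^[φ n])
    rw [integral_map (f := fun p => f (F p)) (hFm.iterate _).aemeasurable
        (hfc.comp hFc).aestronglyMeasurable,
      integral_map (hFm.iterate _).aemeasurable hfc.aestronglyMeasurable]
    simp only [Function.comp_apply, ← Function.iterate_succ_apply, ← Function.iterate_succ_apply']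

end SolenoidData

end Solenoid

end

theorem mainTheorem12 (T : UnitAddCircle → UnitAddCircle) (G : Solenoid.SolidTorus → Solenoid.Disc)
    (hF : Solenoid.IsSolenoidal T G) :
    (∃ D β : ℝ, 0 < D ∧ 0 < β ∧ β < 1 ∧
      ∀ μ ∈ Solenoid.zeroAverage, ∀ n : ℕ, 1 ≤ n →
        (Solenoid.transfer (Solenoid.skewProduct T G))^[n] μ ∈ Solenoid.spaceL1 ∧
        Solenoid.weakNorm ((Solenoid.transfer (Solenoid.skewProduct T G))^[n] μ) ≤
          ENNReal.ofReal (D * β ^ n) *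
            (Solenoid.weakNorm μ + Solenoid.sobolevNorm (Solenoid.marginalDensity μ))) ∧
    (∃ μ ∈ Solenoid.spaceL1, 0 ≤ μ ∧ μ Set.univ = 1 ∧
      Solenoid.transfer (Solenoid.skewProduct T G) μ = μ ∧
      ∀ ν ∈ Solenoid.spaceL1, Solenoid.transfer (Solenoid.skewProduct T G) ν = ν →
        ν = ν Set.univ • μ) := by
  obtain ⟨a, θ, α, S⟩ := hF.exists_solenoidData
  refine ⟨?_, ?_⟩
  · obtain ⟨D, β, hD, hβ, hβ1, h⟩ := S.exponential_convergence
    exact ⟨D, β, hD, hβ, hβ1, fun μ hμ n _ =>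
      ⟨(S.isAB_iterate_transfer hμ.1.1 n).mem_spaceL1, h μ hμ n⟩⟩
  · obtain ⟨ρ, hρ, hac, hinv⟩ := S.exists_invariant
    -- Writing the signed measure as `ρ - 0` gives membership in `𝒜ℬ` and invariance without
    -- computing its Jordan decomposition.
    have hdiff : Solenoid.IsDiff ρ.toSignedMeasure ρ 0 := fun E hE => by
      rw [Measure.toSignedMeasure_apply_measurable hE]
      simp
    refine ⟨ρ.toSignedMeasure, (hdiff.isAB hac ?_).mem_spaceL1, ρ.zero_le_toSignedMeasure, ?_, ?_,
      fun ν hν hνinv => S.eq_smul_of_invariant hac hinv hν hνinv⟩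
    · rw [Measure.fst, Measure.map_zero]
      exact Measure.AbsolutelyContinuous.zero _
    · rw [Measure.toSignedMeasure_apply_measurable MeasurableSet.univ]
      simp
    · have h := Solenoid.isDiff_transfer S.continuous.measurable hdiff
      rw [hinv, Measure.map_zero] at h
      exact Solenoid.eq_of_isDiff h hdiff
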